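/- Consider the one-dimensional Hegselmann--Krause dynamics with a finite set $N$ of non-strategic agents and a finite set $S$ of strategic agents. At each time $t\in\mathbb{N}_{\ge 0}$ every agent $j\in A=N\cup S$ has an opinion $x_j(t)\in\mathbb{R}$; the opinions of the strategic agents may be chosen freely at each time step, while for every $i\in N$ $$x_i(t+1)=\frac{\sum_{j\in A:\,|x_i(t)-x_j(t)|\le 1}x_j(t)}{\left|\{j\in A:\,|x_i(t)-x_j(t)|\le 1\}\right|}.$$ The system has converged at time $t$ if for all $i,j\in N$ either $x_i(t)=x_j(t)$ or $|x_i(t)-x_j(t)|>1$. The convergence time is the smallest $t$ at which the system has converged; the uncontrolled convergence time is the one for $S=\emptyset$, and the optimal convergence time with $m$ strategic agents is the minimum of the convergence time over all choices of the opinions of $m=|S|$ strategic agents. For an integer $k\ge 10$ the dumbbell configuration has $n=3k+1$ non-strategic agents: $k$ agents with starting opinion $-\frac1k$, one agent with starting opinion $i$ for each $0\le i\le k$, and $k$ agents with starting opinion $k+\frac1k$. There are constants $c,C>0$ such that for every integer $k\ge 10$, with $n=3k+1$: 1. the uncontrolled convergence time of the dumbbell configuration is finite and at least $c\,n^2$;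 2. its optimal convergence time with one strategic agent is finite and at most $C\,n^{3/4}$; 3. if one strategic agent has opinion $2$ at time $0$ and opinion $k-2$ at time $1$, then at time $2$ the opinions of the non-strategic agents, numbered $1,\dots,3k+1$ in the order of their starting opinions, are $x_i(2)=-\frac{k}{(k+1)^2}$ for $1\le i\le k+1$; $x_{k+2}(2)=\frac{13}{8}$, $x_{k+3}(2)=2$, $x_{k+4}(2)=\frac{19}{8}$; $x_{k+5}(2)=\frac92$ and $x_{k+1+i}(2)=i$ for $5\le i\le k-4$; $x_{2k-2}(2)=k-\frac{11}{4}$, $x_{2k-1}(2)=k-2$, $x_{2k}(2)=k-\frac54$; $x_{2k+1}(2)=k-\frac{1}{(k+1)(k+2)}$ and $x_{2k+1+i}(2)=k+\frac{k}{(k+1)^2}$ for $1\le i\le k$. (Thus agents $k+5,\dots,2k-3$ form a chain all of whose consecutive distances are $1$, except the first, which is $\frac12$, and all other non-strategic agents are more than $1$ away from this chain.) -/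

import Mathlib

namespace HegselmannKrause

/-- The neighbourhood of the non-strategic agent `i`, among all agents `N ⊕ S`, where `x` gives the
current opinions of the non-strategic agents and `u` those of the strategic agents. -/
noncomputable def neighborhood {N S : Type*} [Fintype N] [Fintype S] (x : N → ℝ) (u : S → ℝ)
    (i : N) : Finset (N ⊕ S) :=
  Finset.univ.filter fun j => |x i - Sum.elim x u j| ≤ 1

/-- One step of the dynamics: each non-strategic agent moves to the mean opinion of its
neighbours (itself included). -/
noncomputable def step {N S : Type*} [Fintype N] [Fintype S] (x : N → ℝ) (u : S → ℝ) : N → ℝ :=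
  fun i => (∑ j ∈ neighborhood x u i, Sum.elim x u j) / ((neighborhood x u i).card : ℝ)

/-- The opinions of the non-strategic agents at each time, for starting opinions `x₀`, if strategic
agent `s` has opinion `u t s` at time `t`. -/
noncomputable def opinions {N S : Type*} [Fintype N] [Fintype S] (x₀ : N → ℝ) (u : ℕ → S → ℝ) :
    ℕ → N → ℝ
  | 0 => x₀
  | t + 1 => step (opinions x₀ u t) (u t)

/-- All non-strategic agents are frozen. -/
def Converged {N : Type*} (x : N → ℝ) : Prop :=
  ∀ i j, x i = x j ∨ 1 < |x i - x j|

/-- The least time at which the system has converged (`⊤` if there is none). -/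
noncomputable def convergenceTime {N S : Type*} [Fintype N] [Fintype S] (x₀ : N → ℝ)
    (u : ℕ → S → ℝ) : ℕ∞ :=
  ⨅ (t : ℕ) (_ : Converged (opinions x₀ u t)), (t : ℕ∞)

/-- The convergence time in the absence of strategic agents. -/
noncomputable def uncontrolledConvergenceTime {N : Type*} [Fintype N] (x₀ : N → ℝ) : ℕ∞ :=
  convergenceTime x₀ (fun _ (s : Fin 0) => s.elim0)

/-- The least convergence time that `m` strategic agents can bring about. -/
noncomputable def optimalConvergenceTime {N : Type*} [Fintype N] (x₀ : N → ℝ) (m : ℕ) : ℕ∞ :=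
  ⨅ u : ℕ → Fin m → ℝ, convergenceTime x₀ u

/-- The dumbbell configuration (agents in increasing order of opinion, numbered from `0`):
`k` agents at `-1/k`, one agent at each of `0, …, k`, and `k` agents at `k + 1/k`. -/
noncomputable def dumbbell (k : ℕ) (i : Fin (3 * k + 1)) : ℝ :=
  if (i : ℕ) < k then -(1 / (k : ℝ))
  else if (i : ℕ) ≤ 2 * k then (i : ℝ) - (k : ℝ)
  else (k : ℝ) + 1 / (k : ℝ)

/-- Two groups of `k + 1` agents around `0` and `k`, two groups of three agents around `2` and
`k - 2`, and in between the chain `9/2, 5, 6, …, k - 4`, whose members have the numbers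
`k + 4, …, 2 * k - 4`. -/
noncomputable def almostEquidistantChain (k : ℕ) (i : Fin (3 * k + 1)) : ℝ :=
  if (i : ℕ) ≤ k then -((k : ℝ) / ((k : ℝ) + 1) ^ 2)
  else if (i : ℕ) = k + 1 then 13 / 8
  else if (i : ℕ) = k + 2 then 2
  else if (i : ℕ) = k + 3 then 19 / 8
  else if (i : ℕ) = k + 4 then 9 / 2
  else if (i : ℕ) + 4 ≤ 2 * k then (i : ℝ) - (k : ℝ)
  else if (i : ℕ) + 3 = 2 * k then (k : ℝ) - 11 / 4
  else if (i : ℕ) + 2 = 2 * k then (k : ℝ) - 2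
  else if (i : ℕ) + 1 = 2 * k then (k : ℝ) - 5 / 4
  else if (i : ℕ) = 2 * k then (k : ℝ) - 1 / (((k : ℝ) + 1) * ((k : ℝ) + 2))
  else (k : ℝ) + (k : ℝ) / ((k : ℝ) + 1) ^ 2

end HegselmannKrause

/-!
All three parts work with opinions that are sorted and indexed by natural numbers (`lineStep`,
`lineOpinions`). The dynamics preserve the order of the agents, neighbourhoods are intervals of
indices, and a gap of more than `1` between consecutive agents (`Cut`) persists as long as no
strategic agent stands in it; so the agents between two cuts evolve on their own.

*Cubic convergence of blocks* (`FreeOrbit.resolved_of_card`). Consider `m` agents between two cuts,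
without control. Either the first of them belongs to a group that is isolated and all of whose
members see each other, which collapses to a point in one step, or it advances by at least
`1 / (2 m²)` in two steps (`FreeOrbit.split_or_advance`). If no cut lies inside the block, its
diameter is less than `m`. Hence the block is resolved after `4 m³` steps, and in particular the
uncontrolled convergence time is finite.

*One strategic agent.* In a chain with distances exactly `1`, a strategic agent at the opinion of
agent `p` pulls both neighbours of `p` inwards, and this cuts the chain on both sides of the three
agents (`ExactOn.cut_chain`). The ends of the chain disturb at most two further agents per step, so
cutting alternately from the left and from the right (`cuttingControl`) divides all of the chain
into pieces of `D` agents in about `k / D` steps. By the cubic bound the pieces are resolved after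
`O(D³)` further steps, and `D ≈ k ^ (1 / 4)` makes both contributions `O(k ^ (3 / 4))`. The opinions
at time `2` are found by following each agent.

*The lower bound.* While the uncontrolled dumbbell keeps its original neighbourhoods, the deficits
`1 - (x (i + 1) - x i)` along the chain obey the discrete heat equation, and the clusters feed at
most `3 / k²` per step into them at the ends. A truncated parabola plus a linear function of time
is a supersolution (`barrier`); it stays below `1 / (2 k)` up to time `k² / 1000`. As the distance
between a cluster and its neighbour in the chain is always more than that, no cluster agent ever
sees the second agent of the chain, so the neighbourhoods do not change
(`IsDumbbell.succ`), and the system has not converged.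
-/

namespace HegselmannKrause
open Finset

/-! ### Agents on a line, indexed by natural numbers -/

/-- The agents `j < n` within distance `1` of agent `i`. -/
noncomputable def nbrs (n : ℕ) (x : ℕ → ℝ) (i : ℕ) : Finset ℕ :=
  (range n).filter fun j => |x i - x j| ≤ 1

/-- The strategic agents within distance `1` of agent `i`. -/
noncomputable def ctrls {S : Type*} [Fintype S] (x : ℕ → ℝ) (u : S → ℝ) (i : ℕ) : Finset S :=
  univ.filter fun s => |x i - u s| ≤ 1

/-- One step of the dynamics, for opinions indexed by natural numbers, of which only those below
`n` belong to agents. -/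
noncomputable def lineStep {S : Type*} [Fintype S] (n : ℕ) (x : ℕ → ℝ) (u : S → ℝ) (i : ℕ) : ℝ :=
  (∑ j ∈ nbrs n x i, x j + ∑ s ∈ ctrls x u i, u s) / ((#(nbrs n x i) : ℝ) + #(ctrls x u i))

/-- The trajectory under `lineStep`. -/
noncomputable def lineOpinions {S : Type*} [Fintype S] (n : ℕ) (x₀ : ℕ → ℝ) (u : ℕ → S → ℝ) :
    ℕ → ℕ → ℝ
  | 0 => x₀
  | t + 1 => lineStep n (lineOpinions n x₀ u t) (u t)

section Transfer

variable {S : Type*} [Fintype S] {n : ℕ} {x : ℕ → ℝ}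

theorem mem_nbrs {i j : ℕ} : j ∈ nbrs n x i ↔ j < n ∧ |x i - x j| ≤ 1 := by
  simp [nbrs]

theorem self_mem_nbrs {i : ℕ} (hi : i < n) : i ∈ nbrs n x i := by
  simp [mem_nbrs, hi]

theorem mem_ctrls {u : S → ℝ} {i : ℕ} {s : S} : s ∈ ctrls x u i ↔ |x i - u s| ≤ 1 := by
  simp [ctrls]

theorem step_eq_lineStep (x : ℕ → ℝ) (u : S → ℝ) (i : Fin n) :
    step (fun j : Fin n => x j) u i = lineStep n x u i := by
  unfold step lineStep neighborhood nbrs ctrls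
  rw [← Nat.cast_add]
  congr 1
  · rw [sum_filter, Fintype.sum_sum_type, sum_filter, sum_filter]
    congr 1
    exact Fin.sum_univ_eq_sum_range (fun j => if |x i - x j| ≤ 1 then x j else 0) n
  · congr 1
    rw [card_filter, Fintype.sum_sum_type, card_filter, card_filter]
    congr 1
    exact Fin.sum_univ_eq_sum_range (fun j => if |x i - x j| ≤ 1 then 1 else 0) n

theorem opinions_eq_lineOpinions (x₀ : ℕ → ℝ) (u : ℕ → S → ℝ) (t : ℕ) :
    opinions (fun j : Fin n => x₀ j) u t = fun j : Fin n => lineOpinions n x₀ u t j := by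
  induction t with
  | zero => rfl
  | succ t ih =>
    funext i
    rw [opinions, ih]
    exact step_eq_lineStep _ _ i

end Transfer

/-! ### Order preservation -/

/-- If every member of `A \ B` lies below all of `B`, and every member of `B \ A` above all of
`A`, then the mean over `A` is at most the mean over `B`. -/
theorem mean_le_mean {ι : Type*} [DecidableEq ι] {A B : Finset ι} (f : ι → ℝ)
    (hA : A.Nonempty) (hB : B.Nonempty)
    (hAB : ∀ a ∈ A \ B, ∀ b ∈ B, f a ≤ f b) (hBA : ∀ b ∈ B \ A, ∀ a ∈ A, f a ≤ f b) :
    (∑ a ∈ A, f a) / (#A : ℝ) ≤ (∑ b ∈ B, f b) / (#B : ℝ) := by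
  have hA' : (0 : ℝ) < #A := by exact_mod_cast hA.card_pos
  have hB' : (0 : ℝ) < #B := by exact_mod_cast hB.card_pos
  rw [div_le_div_iff₀ hA' hB']
  have key : 0 ≤ ∑ a ∈ A, ∑ b ∈ B, (f b - f a) := by
    -- The pairs in `(A ∩ B) × (A ∩ B)` cancel, and all others contribute nonnegative terms.
    rw [← sum_inter_add_sum_sdiff A B]
    have h1 : 0 ≤ ∑ a ∈ A \ B, ∑ b ∈ B, (f b - f a) :=
      sum_nonneg fun a ha => sum_nonneg fun b hb => sub_nonneg.2 (hAB a ha b hb)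
    have h2 : ∀ a ∈ A ∩ B, ∑ b ∈ B, (f b - f a) =
        ∑ b ∈ A ∩ B, (f b - f a) + ∑ b ∈ B \ A, (f b - f a) := fun a _ => by
      rw [← sum_inter_add_sum_sdiff B A, inter_comm]
    rw [sum_congr rfl h2, sum_add_distrib]
    have h3 : 0 ≤ ∑ a ∈ A ∩ B, ∑ b ∈ B \ A, (f b - f a) :=
      sum_nonneg fun a ha => sum_nonneg fun b hb =>
        sub_nonneg.2 (hBA b hb a (mem_of_mem_inter_left ha))
    have h4 : ∑ a ∈ A ∩ B, ∑ b ∈ A ∩ B, (f b - f a) = 0 := by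
      simp only [sum_sub_distrib, sum_const, nsmul_eq_mul]
      rw [← mul_sum]
      ring
    linarith
  simp only [sum_sub_distrib, sum_const, nsmul_eq_mul] at key
  rw [← mul_sum] at key
  linarith

theorem step_le_step {N S : Type*} [Fintype N] [Fintype S] (x : N → ℝ) (u : S → ℝ) {i j : N}
    (h : x i ≤ x j) : step x u i ≤ step x u j := by
  classical
  have hne : ∀ i, (neighborhood x u i).Nonempty := fun i => ⟨Sum.inl i, by simp [neighborhood]⟩
  refine mean_le_mean (Sum.elim x u) (hne i) (hne j) ?_ ?_
  · intro a ha b hb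
    simp only [neighborhood, mem_sdiff, mem_filter, mem_univ, true_and, abs_le, not_and_or,
      not_le] at ha hb
    rcases ha with ⟨h1, h2 | h2⟩ <;> linarith
  · intro b hb a ha
    simp only [neighborhood, mem_sdiff, mem_filter, mem_univ, true_and, abs_le, not_and_or,
      not_le] at ha hb
    rcases hb with ⟨h1, h2 | h2⟩ <;> linarith

/-- The first `n` opinions are in increasing order. -/
def Sorted (n : ℕ) (x : ℕ → ℝ) : Prop :=
  ∀ ⦃i j⦄, i ≤ j → j < n → x i ≤ x j

section Line

variable {S : Type*} [Fintype S] {n : ℕ} {x : ℕ → ℝ} {u : S → ℝ}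

theorem lineStep_le_lineStep {i j : ℕ} (hi : i < n) (hj : j < n) (h : x i ≤ x j) :
    lineStep n x u i ≤ lineStep n x u j := by
  have := step_le_step (fun j : Fin n => x j) u (i := ⟨i, hi⟩) (j := ⟨j, hj⟩) h
  rwa [step_eq_lineStep, step_eq_lineStep] at this

theorem lineStep_congr {i j : ℕ} (hi : i < n) (hj : j < n) (h : x i = x j) :
    lineStep n x u i = lineStep n x u j :=
  le_antisymm (lineStep_le_lineStep hi hj h.le) (lineStep_le_lineStep hj hi h.ge)

theorem Sorted.lineStep (hx : Sorted n x) : Sorted n (lineStep n x u) :=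
  fun _ _ hij hj => lineStep_le_lineStep (hij.trans_lt hj) hj (hx hij hj)

theorem lineStep_le {i : ℕ} (hi : i < n) {M : ℝ} (h : ∀ j ∈ nbrs n x i, x j ≤ M)
    (hu : ∀ s ∈ ctrls x u i, u s ≤ M) : lineStep n x u i ≤ M := by
  have hpos : (0 : ℝ) < #(nbrs n x i) := by
    exact_mod_cast card_pos.2 ⟨i, self_mem_nbrs hi⟩
  unfold HegselmannKrause.lineStep
  rw [div_le_iff₀ (by positivity)]
  have h1 := sum_le_card_nsmul _ _ _ h
  have h2 := sum_le_card_nsmul _ _ _ hu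
  simp only [nsmul_eq_mul] at h1 h2
  linarith

theorem le_lineStep {i : ℕ} (hi : i < n) {M : ℝ} (h : ∀ j ∈ nbrs n x i, M ≤ x j)
    (hu : ∀ s ∈ ctrls x u i, M ≤ u s) : M ≤ lineStep n x u i := by
  have hpos : (0 : ℝ) < #(nbrs n x i) := by
    exact_mod_cast card_pos.2 ⟨i, self_mem_nbrs hi⟩
  unfold HegselmannKrause.lineStep
  rw [le_div_iff₀ (by positivity)]
  have h1 := card_nsmul_le_sum _ _ _ h
  have h2 := card_nsmul_le_sum _ _ _ hu
  simp only [nsmul_eq_mul] at h1 h2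
  linarith

/-- In sorted opinions, the neighbours of an agent form an interval of indices. -/
theorem nbrs_eq_Ico (hx : Sorted n x) {a b i : ℕ} (ha : a ≤ i) (hi : i < b) (hb : b ≤ n)
    (hlo : x i - x a ≤ 1) (hlo' : a = 0 ∨ 1 < x i - x (a - 1))
    (hhi : x (b - 1) - x i ≤ 1) (hhi' : b = n ∨ 1 < x b - x i) : nbrs n x i = Ico a b := by
  ext j
  rw [mem_nbrs, mem_Ico]
  constructor
  · rintro ⟨hj, h⟩
    rw [abs_le] at h
    constructor
    · by_contra! hja
      rcases hlo' with h0 | h0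
      · omega
      · have := hx (show j ≤ a - 1 by omega) (by omega)
        linarith
    · by_contra! hjb
      rcases hhi' with h0 | h0
      · omega
      · have := hx hjb hj
        linarith
  · rintro ⟨h1, h2⟩
    have h3 := hx h1 (by omega)
    have h4 := hx (show j ≤ b - 1 by omega) (by omega)
    exact ⟨by omega, abs_le.2 ⟨by linarith, by linarith⟩⟩

theorem ctrls_eq_empty {i : ℕ} (h : ∀ s, 1 < |x i - u s|) : ctrls x u i = ∅ := by
  ext s
  simp [mem_ctrls, h s]

/-- The mean of the neighbours' opinions, if no strategic agent is near. -/
theorem lineStep_of_far {i : ℕ} (h : ∀ s, 1 < |x i - u s|) :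
    lineStep n x u i = (∑ j ∈ nbrs n x i, x j) / (#(nbrs n x i) : ℝ) := by
  simp [HegselmannKrause.lineStep, ctrls_eq_empty h]

/-- The mean including the strategic agent, if there is just one and it is near. -/
theorem lineStep_of_near {u : Fin 1 → ℝ} {i : ℕ} (h : |x i - u 0| ≤ 1) :
    lineStep n x u i = (∑ j ∈ nbrs n x i, x j + u 0) / ((#(nbrs n x i) : ℝ) + 1) := by
  have : ctrls x u i = {0} := by
    ext s
    simp [mem_ctrls, Subsingleton.elim s 0, h]
  simp [HegselmannKrause.lineStep, this]

end Line

/-! ### Cuts -/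

/-- The agents with index below `c` are more than `1` below those with index at least `c`. -/
def Cut (n : ℕ) (x : ℕ → ℝ) (c : ℕ) : Prop :=
  ∀ ⦃i j⦄, i < c → c ≤ j → j < n → x i + 1 < x j

section Cut

variable {S : Type*} [Fintype S] {n : ℕ} {x : ℕ → ℝ} {u : S → ℝ} {c : ℕ}

theorem cut_zero : Cut n x 0 := fun _ _ h => absurd h (Nat.not_lt_zero _)

theorem cut_self : Cut n x n := fun _ _ _ h h' => absurd h' (not_lt.2 h)

theorem Sorted.cut (hx : Sorted n x) (hc : 0 < c) (h : x (c - 1) + 1 < x c) : Cut n x c := by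
  intro i j hi hj hjn
  have h1 := hx (show i ≤ c - 1 by omega) (by omega)
  have h2 := hx hj hjn
  linarith

/-- A cut persists if no strategic agent that is near to some other agent has its opinion strictly
inside the gap. -/
theorem Cut.lineStep (hx : Sorted n x) (h : Cut n x c)
    (hu : 0 < c → c < n → ∀ s, u s ≤ x (c - 1) ∨ x c ≤ u s ∨ ∀ i < n, 1 < |x i - u s|) :
    Cut n (lineStep n x u) c := by
  intro i j hi hj hjn
  have hu := hu (by omega) (by omega)
  have hgap := h (show c - 1 < c by omega) le_rfl (by omega)
  have h1 : HegselmannKrause.lineStep n x u i ≤ x (c - 1) := by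
    refine lineStep_le (by omega) (fun l hl => ?_) fun s hs => ?_
    · rw [mem_nbrs, abs_le] at hl
      by_contra! hlc
      have h3 : c ≤ l := by
        by_contra! hlt
        exact absurd (hx (show l ≤ c - 1 by omega) (by omega)) (not_le.2 hlc)
      have := h hi h3 hl.1
      linarith
    · rcases hu s with h3 | h3 | h3
      · exact h3
      · rw [mem_ctrls, abs_le] at hs
        have := hx (show i ≤ c - 1 by omega) (by omega)
        linarith
      · exact absurd (mem_ctrls.1 hs) (not_le.2 (h3 i (by omega)))
  have h2 : x c ≤ HegselmannKrause.lineStep n x u j := by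
    refine le_lineStep hjn (fun l hl => ?_) fun s hs => ?_
    · rw [mem_nbrs, abs_le] at hl
      by_contra! hlc
      have h3 : l < c := by
        by_contra! hlt
        exact absurd (hx hlt hl.1) (not_le.2 hlc)
      have := h h3 hj hjn
      linarith
    · rcases hu s with h3 | h3 | h3
      · rw [mem_ctrls, abs_le] at hs
        have := hx hj hjn
        linarith
      · exact h3
      · exact absurd (mem_ctrls.1 hs) (not_le.2 (h3 j hjn))
  linarith

/-- An isolated group within distance `1` reaches consensus in one step if no strategic agent is
near. -/
theorem lineStep_eq_of_block {a b : ℕ} (ha : Cut n x a) (hb : Cut n x b) (hbn : b ≤ n)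
    (hd : ∀ i j, a ≤ i → i < b → a ≤ j → j < b → x j ≤ x i + 1)
    (hu : ∀ i, a ≤ i → i < b → ∀ s, 1 < |x i - u s|) {i j : ℕ} (hi : a ≤ i) (hib : i < b)
    (hj : a ≤ j) (hjb : j < b) : lineStep n x u i = lineStep n x u j := by
  have key : ∀ i, a ≤ i → i < b → nbrs n x i = Ico a b := by
    intro i hi hib
    ext l
    rw [mem_nbrs, mem_Ico, abs_le]
    constructor
    · rintro ⟨hl, h1, h2⟩
      constructor
      · by_contra! h
        have := ha h hi (by omega)
        linarith
      · by_contra! h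
        have := hb hib h hl
        linarith
    · rintro ⟨h1, h2⟩
      have h3 := hd i l hi hib h1 h2
      have h4 := hd l i h1 h2 hi hib
      exact ⟨by omega, by linarith, by linarith⟩
  rw [lineStep_of_far (hu i hi hib), lineStep_of_far (hu j hj hjb), key i hi hib, key j hj hjb]

end Cut

/-! ### Free evolution of a block of agents -/

/-- The orbit `X` evolves without any strategic agent ever being near. -/
structure FreeOrbit {S : Type*} [Fintype S] (n : ℕ) (X : ℕ → ℕ → ℝ) (u : ℕ → S → ℝ) : Prop where
  succ : ∀ t, X (t + 1) = lineStep n (X t) (u t)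
  far : ∀ t, ∀ i < n, ∀ s, 1 < |X t i - u t s|
  sorted : Sorted n (X 0)

/-- Any two agents with index in `[a, b)` are at equal opinions or more than `1` apart. -/
def Resolved (x : ℕ → ℝ) (a b : ℕ) : Prop :=
  ∀ ⦃i j⦄, a ≤ i → i ≤ j → j < b → x i = x j ∨ x i + 1 < x j

theorem Resolved.append {n : ℕ} {x : ℕ → ℝ} {a b c : ℕ} (h : Resolved x a b)
    (h' : Resolved x b c) (hb : Cut n x b) (hc : c ≤ n) : Resolved x a c := by
  intro i j hi hij hj
  rcases lt_or_ge j b with hjb | hjb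
  · exact h hi hij hjb
  · rcases lt_or_ge i b with hib | hib
    · exact Or.inr (hb hib hjb (by omega))
    · exact h' hib hij hj

/-- If at most `m` agents are near agent `i`, all at opinions at least `L` and one of them at least
`L + d`, then agent `i` moves to at least `L + d / m`. -/
theorem add_div_le_lineStep {S : Type*} [Fintype S] {n m : ℕ} {x : ℕ → ℝ} {u : S → ℝ} {i q : ℕ}
    {L d : ℝ} (hu : ∀ s, 1 < |x i - u s|) (hm : #(nbrs n x i) ≤ m)
    (hL : ∀ j ∈ nbrs n x i, L ≤ x j) (hq : q ∈ nbrs n x i) (hd : 0 ≤ d) (hqd : L + d ≤ x q) :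
    L + d / m ≤ lineStep n x u i := by
  have hc : (0 : ℝ) < #(nbrs n x i) := by exact_mod_cast card_pos.2 ⟨q, hq⟩
  have hm' : (#(nbrs n x i) : ℝ) ≤ m := by exact_mod_cast hm
  rw [lineStep_of_far hu]
  have h1 : L + d / m ≤ L + d / #(nbrs n x i) := by gcongr
  refine h1.trans ?_
  rw [le_div_iff₀ hc, add_mul, div_mul_cancel₀ _ hc.ne']
  have h2 : ∑ j ∈ nbrs n x i, (x j - L) ≥ x q - L :=
    single_le_sum (f := fun j => x j - L) (fun j hj => sub_nonneg.2 (hL j hj)) hq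
  rw [sum_sub_distrib, sum_const, nsmul_eq_mul] at h2
  linarith

/-- The bound corresponding to `add_div_le_lineStep` from above. -/
theorem lineStep_le_sub_div {S : Type*} [Fintype S] {n m : ℕ} {x : ℕ → ℝ} {u : S → ℝ} {i q : ℕ}
    {M d : ℝ} (hu : ∀ s, 1 < |x i - u s|) (hm : #(nbrs n x i) ≤ m)
    (hM : ∀ j ∈ nbrs n x i, x j ≤ M) (hq : q ∈ nbrs n x i) (hd : 0 ≤ d) (hqd : x q ≤ M - d) :
    lineStep n x u i ≤ M - d / m := by
  have hc : (0 : ℝ) < #(nbrs n x i) := by exact_mod_cast card_pos.2 ⟨q, hq⟩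
  have hm' : (#(nbrs n x i) : ℝ) ≤ m := by exact_mod_cast hm
  rw [lineStep_of_far hu]
  have h1 : M - d / #(nbrs n x i) ≤ M - d / m := by gcongr
  refine le_trans ?_ h1
  rw [div_le_iff₀ hc, sub_mul, div_mul_cancel₀ _ hc.ne']
  have h2 : ∑ j ∈ nbrs n x i, (M - x j) ≥ M - x q :=
    single_le_sum (f := fun j => M - x j) (fun j hj => sub_nonneg.2 (hM j hj)) hq
  rw [sum_sub_distrib, sum_const, nsmul_eq_mul] at h2
  linarith

section Block

variable {S : Type*} [Fintype S] {n : ℕ} {X : ℕ → ℕ → ℝ} {u : ℕ → S → ℝ}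

theorem nbrs_subset_block {x : ℕ → ℝ} {a b i : ℕ} (ha : Cut n x a) (hb : Cut n x b) (hbn : b ≤ n)
    (hi : a ≤ i) (hib : i < b) : nbrs n x i ⊆ Ico a b := by
  intro j hj
  rw [mem_nbrs, abs_le] at hj
  rw [mem_Ico]
  constructor
  · by_contra! h
    have := ha h hi (by omega)
    linarith
  · by_contra! h
    have := hb hib h hj.1
    linarith

theorem card_nbrs_le_of_block {x : ℕ → ℝ} {a b i m : ℕ} (ha : Cut n x a) (hb : Cut n x b)
    (hbn : b ≤ n) (hm : b ≤ a + m) (hi : a ≤ i) (hib : i < b) : #(nbrs n x i) ≤ m := by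
  have := card_le_card (nbrs_subset_block ha hb hbn hi hib)
  rw [Nat.card_Ico] at this
  omega

namespace FreeOrbit

variable (hX : FreeOrbit n X u)
include hX

theorem sorted_at (t : ℕ) : Sorted n (X t) := by
  induction t with
  | zero => exact hX.sorted
  | succ t ih => rw [hX.succ]; exact ih.lineStep

theorem cut_succ {t c : ℕ} (h : Cut n (X t) c) : Cut n (X (t + 1)) c := by
  rw [hX.succ]
  exact h.lineStep (hX.sorted_at t) fun _ _ s => Or.inr (Or.inr fun i hi => hX.far t i hi s)

theorem cut_of_le {t t' c : ℕ} (htt : t ≤ t') (h : Cut n (X t) c) : Cut n (X t') c := by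
  induction t', htt using Nat.le_induction with
  | base => exact h
  | succ t' _ ih => exact hX.cut_succ ih

theorem eq_of_le {t t' i j : ℕ} (htt : t ≤ t') (hi : i < n) (hj : j < n) (h : X t i = X t j) :
    X t' i = X t' j := by
  induction t', htt using Nat.le_induction with
  | base => exact h
  | succ t' _ ih => rw [hX.succ]; exact lineStep_congr hi hj ih

theorem first_le_succ {t a b : ℕ} (ha : Cut n (X t) a) (hb : Cut n (X t) b) (hab : a < b)
    (hbn : b ≤ n) : X t a ≤ X (t + 1) a := by
  rw [hX.succ]
  refine le_lineStep (by omega) (fun j hj => ?_) fun s hs => ?_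
  · have := mem_Ico.1 (nbrs_subset_block ha hb hbn le_rfl hab hj)
    exact hX.sorted_at t this.1 (by omega)
  · exact absurd (mem_ctrls.1 hs) (not_le.2 (hX.far t a (by omega) s))

theorem succ_last_le {t a b : ℕ} (ha : Cut n (X t) a) (hb : Cut n (X t) b) (hab : a < b)
    (hbn : b ≤ n) : X (t + 1) (b - 1) ≤ X t (b - 1) := by
  rw [hX.succ]
  refine lineStep_le (by omega) (fun j hj => ?_) fun s hs => ?_
  · have := mem_Ico.1 (nbrs_subset_block ha hb hbn (by omega) (by omega) hj)
    exact hX.sorted_at t (by omega) (by omega)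
  · exact absurd (mem_ctrls.1 hs) (not_le.2 (hX.far t (b - 1) (by omega) s))

/-- The engine of convergence: the first agent of an isolated block of at most `m` agents either
belongs to an isolated group of agents that all see each other, or advances by at least
`1 / (2 m²)` within two steps. In the latter case, the last neighbour of the first agent sees an
agent outside the neighbourhood of the first one; so unless it is at distance `1 / (2 m)` already,
it is so one step later. -/
theorem split_or_advance {t a b m : ℕ} (ha : Cut n (X t) a) (hb : Cut n (X t) b) (hab : a < b)
    (hbn : b ≤ n) (hm : b ≤ a + m) :
    (∃ r, a < r ∧ r ≤ b ∧ Cut n (X t) r ∧ X t (r - 1) ≤ X t a + 1 ∧ (r < b → X t a + 1 < X t r)) ∨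
      X t a + 1 / (2 * (m : ℝ) ^ 2) ≤ X (t + 2) a := by
  have hm0 : (0 : ℝ) < m := by
    have : 0 < m := by omega
    exact_mod_cast this
  have hs := hX.sorted_at t
  -- `r` is the first agent of the block that is not a neighbour of `a`, or `b`.
  have hex : ∃ r, a < r ∧ (r = b ∨ X t a + 1 < X t r) := ⟨b, hab, Or.inl rfl⟩
  classical
  let r := Nat.find hex
  obtain ⟨har, hr⟩ : a < r ∧ (r = b ∨ X t a + 1 < X t r) := Nat.find_spec hex
  have hrb : r ≤ b := Nat.find_min' hex ⟨hab, Or.inl rfl⟩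
  have hr1 : X t (r - 1) ≤ X t a + 1 := by
    rcases Nat.lt_or_ge a (r - 1) with h | h
    · have := Nat.find_min hex (show r - 1 < r by omega)
      push Not at this
      exact (this h).2
    · rw [show r - 1 = a by omega]
      linarith
  by_cases hcut : Cut n (X t) r
  · refine Or.inl ⟨r, har, hrb, hcut, hr1, fun h => ?_⟩
    rcases hr with h' | h'
    · omega
    · exact h'
  right
  have hrb' : r < b := by
    rcases hrb.lt_or_eq with h | h
    · exact h
    · rw [h] at hcut; exact absurd hb hcut
  have har1 : X t a + 1 < X t r := by
    rcases hr with h' | h'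
    · omega
    · exact h'
  have hgap : X t r ≤ X t (r - 1) + 1 := by
    by_contra! h
    exact hcut (hs.cut (by omega) h)
  have ha' := hX.cut_succ ha
  have hb' := hX.cut_succ hb
  have hfirst := hX.first_le_succ ha hb hab hbn
  have hfirst' := hX.first_le_succ ha' hb' hab hbn
  have hc := card_nbrs_le_of_block ha hb hbn hm le_rfl hab
  have hL : ∀ i, a ≤ i → i < b → ∀ j ∈ nbrs n (X t) i, X t a ≤ X t j := fun i hi hib j hj => by
    have := mem_Ico.1 (nbrs_subset_block ha hb hbn hi hib hj)
    exact hs this.1 (by omega)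
  have hq0 : X t a ≤ X t (r - 1) := hs (by omega) (by omega)
  rcases le_or_gt (X t a + 1 / (2 * m)) (X t (r - 1)) with hcase | hcase
  · have hmem : r - 1 ∈ nbrs n (X t) a :=
      mem_nbrs.2 ⟨by omega, abs_le.2 ⟨by linarith, by linarith⟩⟩
    have := add_div_le_lineStep (hX.far t a (by omega)) hc (hL a le_rfl hab) hmem
      (by positivity) hcase
    rw [← hX.succ] at this
    have h2 : (1 : ℝ) / (2 * m) / m = 1 / (2 * (m : ℝ) ^ 2) := by field_simp
    rw [h2] at this
    exact this.trans hfirst'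
  · have hcq := card_nbrs_le_of_block ha hb hbn hm (show a ≤ r - 1 by omega) (by omega)
    have hLq := hL (r - 1) (by omega) (by omega)
    have hfar := hX.far t (r - 1) (by omega)
    -- The agent `r - 1` moves away from `a` by at least `1 / m`, …
    have hup : X t a + 1 / m ≤ X (t + 1) (r - 1) := by
      rw [hX.succ]
      exact add_div_le_lineStep hfar hcq hLq
        (mem_nbrs.2 ⟨by omega, abs_le.2 ⟨by linarith, by
          have := hs (show r - 1 ≤ r by omega) (by omega); linarith⟩⟩ : r ∈ nbrs n (X t) (r - 1))
        (by norm_num) har1.le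
    -- … but stays a neighbour of it.
    have hdown : X (t + 1) (r - 1) ≤ X t a + 1 := by
      rw [hX.succ]
      have h := lineStep_le_sub_div (M := X t a + 1 / (2 * m) + 1) (d := 1 / (2 * m) + 1)
        hfar hcq (fun j hj => ?_)
        (mem_nbrs.2 ⟨by omega, abs_le.2 ⟨by linarith, by linarith⟩⟩ : a ∈ nbrs n (X t) (r - 1))
        (by positivity) (by linarith)
      · refine h.trans ?_
        have : (1 : ℝ) / (2 * m) ≤ (1 / (2 * m) + 1) / m := by
          rw [div_le_div_iff₀ (by positivity) hm0]
          have : (1 : ℝ) / (2 * m) > 0 := by positivity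
          nlinarith
        linarith
      · have := abs_le.1 (mem_nbrs.1 hj).2
        linarith
    have hnear : X (t + 1) a ≤ X t (r - 1) := by
      rw [hX.succ]
      refine lineStep_le (by omega) (fun j hj => ?_) fun s hs' => ?_
      · have h1 := mem_nbrs.1 hj
        refine hs ?_ (by omega)
        by_contra! h
        have h2 := hs (show r ≤ j by omega) h1.1
        have h3 := abs_le.1 h1.2
        linarith
      · exact absurd (mem_ctrls.1 hs') (not_le.2 (hX.far t a (by omega) s))
    have hsplit : (1 : ℝ) / m = 1 / (2 * m) + 1 / (2 * m) := by field_simp; norm_num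
    have hmem : r - 1 ∈ nbrs n (X (t + 1)) a := by
      refine mem_nbrs.2 ⟨by omega, abs_le.2 ⟨by linarith, ?_⟩⟩
      have := hX.sorted_at (t + 1) (show a ≤ r - 1 by omega) (by omega)
      linarith
    have := add_div_le_lineStep (L := X (t + 1) a) (d := 1 / (2 * m))
      (hX.far (t + 1) a (by omega))
      (card_nbrs_le_of_block ha' hb' hbn hm le_rfl hab) (fun j hj => by
        have := mem_Ico.1 (nbrs_subset_block ha' hb' hbn le_rfl hab hj)
        exact hX.sorted_at (t + 1) this.1 (by omega)) hmem
      (by positivity) (by linarith)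
    rw [← hX.succ] at this
    have h2 : (1 : ℝ) / (2 * m) / m = 1 / (2 * (m : ℝ) ^ 2) := by field_simp
    rw [h2] at this
    show _ ≤ X (t + 1 + 1) a
    linarith

/-- An isolated block all of whose members see each other is resolved after one step. -/
theorem resolved_of_le_one {t t' a b : ℕ} (ha : Cut n (X t) a) (hb : Cut n (X t) b)
    (hbn : b ≤ n) (hd : X t (b - 1) ≤ X t a + 1) (ht : t + 1 ≤ t') : Resolved (X t') a b := by
  intro i j hi hij hj
  left
  refine hX.eq_of_le ht (by omega) (by omega) ?_
  rw [hX.succ]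
  refine lineStep_eq_of_block ha hb hbn (fun i j hi hib hj hjb => ?_)
    (fun i _ hib => hX.far t i (by omega)) hi (by omega) (by omega) hj
  have h1 := hX.sorted_at t (show j ≤ b - 1 by omega) (by omega)
  have h2 := hX.sorted_at t hi (by omega)
  linarith

/-- An isolated block of at most `m` agents and of diameter at most `s / (2 m²)` is resolved after
`2 s` steps. -/
theorem resolved_of_diam {m : ℕ} (s : ℕ) : ∀ {t t' a b : ℕ}, Cut n (X t) a → Cut n (X t) b →
    a < b → b ≤ n → b ≤ a + m → X t (b - 1) ≤ X t a + s / (2 * (m : ℝ) ^ 2) → t + 2 * s ≤ t' →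
    Resolved (X t') a b := by
  induction s with
  | zero =>
    intro t t' a b ha hb hab hbn hm hd ht i j hi hij hj
    have h1 := hX.sorted_at t (show j ≤ b - 1 by omega) (by omega)
    have h2 := hX.sorted_at t hi (by omega)
    have h3 := hX.sorted_at t hij (by omega)
    simp only [Nat.cast_zero, zero_div] at hd
    exact Or.inl (hX.eq_of_le (t := t) (by omega) (by omega) (by omega) (by linarith))
  | succ s ih =>
    intro t t' a b ha hb hab hbn hm hd ht
    have hm1 : (1 : ℝ) ≤ m := by
      have : 1 ≤ m := by omega
      exact_mod_cast this
    have hsplit : ((s + 1 : ℕ) : ℝ) / (2 * (m : ℝ) ^ 2) =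
        s / (2 * (m : ℝ) ^ 2) + 1 / (2 * (m : ℝ) ^ 2) := by
      push_cast
      ring
    rw [hsplit] at hd
    rcases hX.split_or_advance ha hb hab hbn hm with ⟨r, har, hrb, hr, hr1, hrr⟩ | hadv
    · have hleft : Resolved (X t') a r :=
        hX.resolved_of_le_one ha hr (hrb.trans hbn) hr1 (by omega)
      rcases hrb.lt_or_eq with hlt | rfl
      · refine hleft.append ?_ (hX.cut_of_le (by omega) hr) hbn
        refine ih hr hb hlt hbn (by omega) ?_ (by omega)
        have h1 := hrr hlt
        have h2 : (1 : ℝ) / (2 * (m : ℝ) ^ 2) ≤ 1 := by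
          rw [div_le_one (by positivity)]
          nlinarith
        linarith
      · exact hleft
    · refine ih (t := t + 2) (hX.cut_of_le (by omega) ha) (hX.cut_of_le (by omega) hb) hab hbn hm
        ?_ (by omega)
      have h1 := hX.succ_last_le ha hb hab hbn
      have h2 := hX.succ_last_le (hX.cut_succ ha) (hX.cut_succ hb) hab hbn
      show X (t + 1 + 1) (b - 1) ≤ _
      linarith

/-- An isolated block of at most `m` agents is resolved after `4 m³` steps, whatever its diameter:
a cut inside the block splits it, and without such a cut its diameter is less than `m`. -/
theorem resolved_of_card {m t t' : ℕ} (ht : t + 4 * m ^ 3 ≤ t') : ∀ (d : ℕ) {a b : ℕ}, b = a + d →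
    d ≤ m → Cut n (X t) a → Cut n (X t) b → b ≤ n → Resolved (X t') a b := by
  intro d
  induction d using Nat.strong_induction_on with
  | _ d ih =>
  intro a b hb hm hca hcb hbn
  by_cases hcut : ∃ c, a < c ∧ c < b ∧ Cut n (X t) c
  · obtain ⟨c, hac, hcb', hc⟩ := hcut
    exact (ih (c - a) (by omega) (by omega) (by omega) hca hc (by omega)).append
      (ih (b - c) (by omega) (by omega) (by omega) hc hcb hbn)
      (hX.cut_of_le (by omega) hc) hbn
  · push Not at hcut
    rcases Nat.eq_zero_or_pos d with rfl | hd
    · intro i j hi hij hj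
      omega
    · have hdiam : ∀ e, a + e < b → X t (a + e) ≤ X t a + e := by
        intro e
        induction e with
        | zero => simp
        | succ e ihe =>
          intro he
          have h1 := ihe (by omega)
          have h2 : X t (a + e + 1) ≤ X t (a + e) + 1 := by
            by_contra! h
            exact hcut (a + e + 1) (by omega) (by omega)
              ((hX.sorted_at t).cut (by omega) (by simpa using h))
          push_cast
          rw [← add_assoc]
          linarith
      refine hX.resolved_of_diam (m := m) (2 * m ^ 3) (t := t) hca hcb (by omega) hbn (by omega)
        ?_ (by omega)
      have hm0 : (0 : ℝ) < m := by
        have : 0 < m := by omega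
        exact_mod_cast this
      have h1 := hdiam (d - 1) (by omega)
      rw [show a + (d - 1) = b - 1 by omega] at h1
      have h2 : ((d - 1 : ℕ) : ℝ) ≤ m := by
        have : d - 1 ≤ m := by omega
        exact_mod_cast this
      have h3 : ((2 * m ^ 3 : ℕ) : ℝ) / (2 * (m : ℝ) ^ 2) = m := by
        push_cast
        field_simp
      rw [h3]
      linarith

end FreeOrbit
end Block

theorem Resolved.converged {n : ℕ} {x : ℕ → ℝ} (h : Resolved x 0 n) :
    Converged fun i : Fin n => x i := by
  intro i j
  rcases le_total (i : ℕ) j with hij | hij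
  · rcases h (Nat.zero_le _) hij j.2 with h1 | h1
    · exact Or.inl h1
    · exact Or.inr (lt_abs.2 (Or.inr (by linarith)))
  · rcases h (Nat.zero_le _) hij i.2 with h1 | h1
    · exact Or.inl h1.symm
    · exact Or.inr (lt_abs.2 (Or.inl (by linarith)))

/-! ### Steps of chains and of clusters -/

section Chain

variable {S : Type*} [Fintype S] {n : ℕ} {x : ℕ → ℝ} {u : S → ℝ}

theorem sum_Ico_two (f : ℕ → ℝ) (a : ℕ) : ∑ j ∈ Ico a (a + 2), f j = f a + f (a + 1) := by
  rw [sum_Ico_succ_top (by omega), Nat.Ico_succ_singleton, sum_singleton]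

theorem sum_Ico_three (f : ℕ → ℝ) (a : ℕ) :
    ∑ j ∈ Ico a (a + 3), f j = f a + f (a + 1) + f (a + 2) := by
  rw [sum_Ico_succ_top (by omega), sum_Ico_two]

/-- An agent who sees exactly the next agent on either side. -/
theorem nbrs_eq_Ico_three (hx : Sorted n x) {a : ℕ} (hn : a + 2 < n) (h1 : x (a + 1) - x a ≤ 1)
    (h2 : x (a + 2) - x (a + 1) ≤ 1) (h0 : a = 0 ∨ 1 < x (a + 1) - x (a - 1))
    (h3 : a + 3 = n ∨ 1 < x (a + 3) - x (a + 1)) : nbrs n x (a + 1) = Ico a (a + 3) :=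
  nbrs_eq_Ico hx (by omega) (by omega) (by omega) h1 h0 h2 h3

theorem lineStep_eq_third (hx : Sorted n x) {a : ℕ} (hn : a + 2 < n) (h1 : x (a + 1) - x a ≤ 1)
    (h2 : x (a + 2) - x (a + 1) ≤ 1) (h0 : a = 0 ∨ 1 < x (a + 1) - x (a - 1))
    (h3 : a + 3 = n ∨ 1 < x (a + 3) - x (a + 1)) (hu : ∀ s, 1 < |x (a + 1) - u s|) :
    lineStep n x u (a + 1) = (x a + x (a + 1) + x (a + 2)) / 3 := by
  rw [lineStep_of_far hu, nbrs_eq_Ico_three hx hn h1 h2 h0 h3, sum_Ico_three, Nat.card_Ico]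
  norm_num

theorem lineStep_eq_fourth (hx : Sorted n x) {a : ℕ} {u : Fin 1 → ℝ} (hn : a + 2 < n)
    (h1 : x (a + 1) - x a ≤ 1)
    (h2 : x (a + 2) - x (a + 1) ≤ 1) (h0 : a = 0 ∨ 1 < x (a + 1) - x (a - 1))
    (h3 : a + 3 = n ∨ 1 < x (a + 3) - x (a + 1)) (hu : |x (a + 1) - u 0| ≤ 1) :
    lineStep n x u (a + 1) = (x a + x (a + 1) + x (a + 2) + u 0) / 4 := by
  rw [lineStep_of_near hu, nbrs_eq_Ico_three hx hn h1 h2 h0 h3, sum_Ico_three, Nat.card_Ico]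
  norm_num

/-- The agents with index in `[l, r]` form a chain with distances exactly `1`; agent `j` is
at `j - κ`. -/
def ExactOn (x : ℕ → ℝ) (κ : ℝ) (l r : ℕ) : Prop :=
  ∀ j, l ≤ j → j ≤ r → x j = j - κ

theorem ExactOn.mono {κ : ℝ} {l r l' r' : ℕ} (h : ExactOn x κ l r) (hl : l ≤ l') (hr : r' ≤ r) :
    ExactOn x κ l' r' :=
  fun j h1 h2 => h j (by omega) (by omega)

/-- Agents in the interior of an exact chain stay where they are. -/
theorem ExactOn.lineStep_eq {κ : ℝ} {l r a : ℕ} (hx : Sorted n x) (h : ExactOn x κ l r)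
    (hr : r < n) (hl : l + 1 ≤ a) (hr' : a + 3 ≤ r) (hu : ∀ s, 1 < |x (a + 1) - u s|) :
    lineStep n x u (a + 1) = (a + 1 : ℕ) - κ := by
  obtain ⟨a, rfl⟩ : ∃ c, a = c + 1 := ⟨a - 1, by omega⟩
  have e0 := h a (by omega) (by omega)
  have e1 := h (a + 1) (by omega) (by omega)
  have e2 := h (a + 1 + 1) (by omega) (by omega)
  have e3 := h (a + 1 + 2) (by omega) (by omega)
  have e4 := h (a + 1 + 3) (by omega) (by omega)
  push_cast at e0 e1 e2 e3 e4
  rw [lineStep_eq_third hx (by omega) (by linarith) (by linarith)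
    (Or.inr (by rw [Nat.add_sub_cancel]; linarith)) (Or.inr (by linarith)) hu, e1, e2, e3]
  push_cast
  ring

theorem ExactOn.lineStep_eq_near {κ : ℝ} {l r a : ℕ} {u : Fin 1 → ℝ} (hx : Sorted n x)
    (h : ExactOn x κ l r) (hr : r < n) (hl : l + 1 ≤ a) (hr' : a + 3 ≤ r)
    (hu : |x (a + 1) - u 0| ≤ 1) :
    lineStep n x u (a + 1) = (3 * ((a + 1 : ℕ) - κ) + u 0) / 4 := by
  obtain ⟨a, rfl⟩ : ∃ c, a = c + 1 := ⟨a - 1, by omega⟩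
  have e0 := h a (by omega) (by omega)
  have e1 := h (a + 1) (by omega) (by omega)
  have e2 := h (a + 1 + 1) (by omega) (by omega)
  have e3 := h (a + 1 + 2) (by omega) (by omega)
  have e4 := h (a + 1 + 3) (by omega) (by omega)
  push_cast at e0 e1 e2 e3 e4
  rw [lineStep_eq_fourth hx (by omega) (by linarith) (by linarith)
    (Or.inr (by rw [Nat.add_sub_cancel]; linarith)) (Or.inr (by linarith)) hu, e1, e2, e3]
  push_cast
  ring

/-- A strategic agent at the opinion of agent `p` in an exact chain draws the agents `p - 1` and
`p + 1` inwards by `1 / 4`, and leaves all others in their places. This cuts the chain on both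
sides. -/
theorem ExactOn.cut_chain {κ : ℝ} {l r p : ℕ} {u : Fin 1 → ℝ} (hx : Sorted n x)
    (h : ExactOn x κ l r) (hr : r < n) (hl : l + 4 ≤ p) (hr' : p + 4 ≤ r) (hu : u 0 = x p) :
    ExactOn (lineStep n x u) κ (l + 2) (p - 2) ∧ ExactOn (lineStep n x u) κ (p + 2) (r - 2) ∧
      Cut n (lineStep n x u) (p - 1) ∧ Cut n (lineStep n x u) (p + 2) := by
  have hp := h p (by omega) (by omega)
  have hfar : ∀ j, l ≤ j → j ≤ r → (j + 2 ≤ p ∨ p + 2 ≤ j) → ∀ s, 1 < |x j - u s| := by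
    intro j h1 h2 h3 s
    rw [Subsingleton.elim s 0, hu, h j h1 h2, hp, lt_abs]
    rcases h3 with h3 | h3
    · right
      have : (j : ℝ) + 2 ≤ p := by exact_mod_cast h3
      linarith
    · left
      have : (p : ℝ) + 2 ≤ j := by exact_mod_cast h3
      linarith
  have hstay : ∀ j, l + 2 ≤ j → j + 2 ≤ r → (j + 2 ≤ p ∨ p + 2 ≤ j) →
      HegselmannKrause.lineStep n x u j = j - κ := by
    intro j h1 h2 h3
    obtain ⟨a, rfl⟩ : ∃ a, j = a + 1 := ⟨j - 1, by omega⟩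
    exact h.lineStep_eq hx hr (by omega) (by omega) (hfar _ (by omega) (by omega) h3)
  obtain ⟨a, rfl⟩ : ∃ a, p = a + 2 := ⟨p - 2, by omega⟩
  push_cast at hp
  have hL := h.lineStep_eq_near (u := u) hx hr (a := a) (by omega) (by omega) (by
    rw [hu, hp, h (a + 1) (by omega) (by omega), abs_le]
    push_cast
    constructor <;> linarith)
  have hR := h.lineStep_eq_near (u := u) hx hr (a := a + 2) (by omega) (by omega) (by
    rw [hu, hp, h (a + 2 + 1) (by omega) (by omega), abs_le]
    push_cast
    constructor <;> linarith)
  have h1 := hstay a (by omega) (by omega) (by omega)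
  have h2 := hstay (a + 4) (by omega) (by omega) (by omega)
  rw [hu, hp] at hL hR
  push_cast at hL hR h2
  refine ⟨fun j h1 h2 => hstay j h1 (by omega) (by omega),
    fun j h1 h2 => hstay j (by omega) (by omega) (by omega), ?_, ?_⟩
  · refine Sorted.cut hx.lineStep (by omega) ?_
    rw [show a + 2 - 1 - 1 = a by omega, show a + 2 - 1 = a + 1 by omega, hL, h1]
    linarith
  · refine Sorted.cut hx.lineStep (by omega) ?_
    rw [show a + 2 + 2 - 1 = a + 2 + 1 by omega, show a + 2 + 2 = a + 4 by omega, hR, h2]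
    linarith

/-- If the first `k` agents are in one place and see, besides each other, just agent `k`. -/
theorem lineStep_left_cluster (hx : Sorted n x) {k i : ℕ} {w : ℝ} (hk : k + 1 < n)
    (hw : ∀ i < k, x i = w) (h1 : x k - w ≤ 1) (h2 : 1 < x (k + 1) - w) (hi : i < k)
    (hu : ∀ s, 1 < |w - u s|) : lineStep n x u i = (k * w + x k) / (k + 1) := by
  have hN : nbrs n x i = Ico 0 (k + 1) := by
    refine nbrs_eq_Ico hx (Nat.zero_le _) (by omega) (by omega) ?_ (Or.inl rfl) ?_ (Or.inr ?_)
    · rw [hw i hi, hw 0 (by omega)]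
      norm_num
    · rw [hw i hi]
      exact h1
    · rw [hw i hi]
      exact h2
  rw [lineStep_of_far (by rwa [hw i hi]), hN, sum_Ico_succ_top (by omega),
    sum_congr rfl fun j hj => hw j (mem_Ico.1 hj).2]
  simp

theorem lineStep_right_cluster (hx : Sorted n x) {k a i : ℕ} {v : ℝ} (hk : a + k + 2 = n)
    (hv : ∀ i, a + 1 < i → i < n → x i = v) (h1 : v - x (a + 1) ≤ 1) (h2 : 1 < v - x a)
    (hi : a + 1 < i) (hin : i < n) (hu : ∀ s, 1 < |v - u s|) :
    lineStep n x u i = (x (a + 1) + k * v) / (k + 1) := by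
  have hN : nbrs n x i = Ico (a + 1) n := by
    refine nbrs_eq_Ico hx (by omega) (by omega) (by omega) ?_ (Or.inr ?_) ?_ (Or.inl rfl)
    · rw [hv i hi hin]
      exact h1
    · rw [hv i hi hin]
      exact h2
    · rw [hv i hi hin, hv (n - 1) (by omega) (by omega)]
      norm_num
  rw [lineStep_of_far (by rwa [hv i hi hin]), hN, sum_eq_sum_Ico_succ_bot (by omega),
    sum_congr rfl fun j hj => hv j (by have := mem_Ico.1 hj; omega) (mem_Ico.1 hj).2]
  simp only [sum_const, Nat.card_Ico, nsmul_eq_mul]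
  rw [show n - (a + 1 + 1) = k by omega, show n - (a + 1) = k + 1 by omega]
  push_cast
  rfl

/-- The agent between the left cluster and the chain. -/
theorem lineStep_left_joint (hx : Sorted n x) {k : ℕ} {w : ℝ} (hk : k + 2 < n)
    (hw : ∀ i < k, x i = w) (h1 : x k - w ≤ 1) (h2 : x (k + 1) - x k ≤ 1)
    (h3 : 1 < x (k + 2) - x k) (hk0 : 0 < k)
    (hu : ∀ s, 1 < |x k - u s|) : lineStep n x u k = (k * w + x k + x (k + 1)) / (k + 2) := by
  have hN : nbrs n x k = Ico 0 (k + 2) := by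
    refine nbrs_eq_Ico hx (Nat.zero_le _) (by omega) (by omega) ?_ (Or.inl rfl) h2 (Or.inr h3)
    rw [hw 0 hk0]
    exact h1
  rw [lineStep_of_far hu, hN, sum_Ico_succ_top (by omega), sum_Ico_succ_top (by omega),
    sum_congr rfl fun j hj => hw j (mem_Ico.1 hj).2]
  simp

theorem lineStep_right_joint (hx : Sorted n x) {k a : ℕ} {v : ℝ} (hk : a + k + 2 = n)
    (ha : 0 < a) (hk0 : 0 < k)
    (hv : ∀ i, a + 1 < i → i < n → x i = v) (h1 : v - x (a + 1) ≤ 1) (h2 : x (a + 1) - x a ≤ 1)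
    (h3 : 1 < x (a + 1) - x (a - 1)) (hu : ∀ s, 1 < |x (a + 1) - u s|) :
    lineStep n x u (a + 1) = (x a + x (a + 1) + k * v) / (k + 2) := by
  have hN : nbrs n x (a + 1) = Ico a n := by
    refine nbrs_eq_Ico hx (by omega) (by omega) (by omega) h2 (Or.inr h3) ?_ (Or.inl rfl)
    rw [hv (n - 1) (by omega) (by omega)]
    exact h1
  rw [lineStep_of_far hu, hN, sum_eq_sum_Ico_succ_bot (by omega),
    sum_eq_sum_Ico_succ_bot (by omega),
    sum_congr rfl fun j hj => hv j (by have := mem_Ico.1 hj; omega) (mem_Ico.1 hj).2]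
  simp only [sum_const, Nat.card_Ico, nsmul_eq_mul]
  rw [show n - (a + 1 + 1) = k by omega, show n - a = k + 2 by omega]
  push_cast
  rw [add_assoc]

end Chain

/-! ### The first two steps of the controlled dumbbell -/

section Pair

variable {S : Type*} [Fintype S] {n : ℕ} {x : ℕ → ℝ} {u : S → ℝ} {a : ℕ}

theorem lineStep_eq_half_left (hx : Sorted n x) (hn : a + 1 < n) (h1 : x (a + 1) - x a ≤ 1)
    (h0 : a = 0 ∨ 1 < x a - x (a - 1)) (h2 : a + 2 = n ∨ 1 < x (a + 2) - x a)
    (hu : ∀ s, 1 < |x a - u s|) : lineStep n x u a = (x a + x (a + 1)) / 2 := by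
  rw [lineStep_of_far hu, nbrs_eq_Ico hx le_rfl (show a < a + 2 by omega) (by omega)
    (by norm_num) h0 h1 h2, sum_Ico_two, Nat.card_Ico]
  norm_num

theorem lineStep_eq_half_right (hx : Sorted n x) (hn : a + 1 < n) (h1 : x (a + 1) - x a ≤ 1)
    (h0 : a = 0 ∨ 1 < x (a + 1) - x (a - 1)) (h2 : a + 2 = n ∨ 1 < x (a + 2) - x (a + 1))
    (hu : ∀ s, 1 < |x (a + 1) - u s|) : lineStep n x u (a + 1) = (x a + x (a + 1)) / 2 := by
  rw [lineStep_of_far hu, nbrs_eq_Ico hx (show a ≤ a + 1 by omega) (show a + 1 < a + 2 by omega)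
    (by omega) h1 h0 (by simp) h2, sum_Ico_two, Nat.card_Ico]
  norm_num

end Pair

/-- The dumbbell configuration, indexed by natural numbers. -/
noncomputable def dumbbellLine (k i : ℕ) : ℝ :=
  if i < k then -(1 / (k : ℝ))
  else if i ≤ 2 * k then (i : ℝ) - (k : ℝ)
  else (k : ℝ) + 1 / (k : ℝ)

theorem dumbbell_eq (k : ℕ) : dumbbell k = fun i : Fin (3 * k + 1) => dumbbellLine k i := rfl

theorem dumbbellLine_of_lt {k i : ℕ} (h : i < k) : dumbbellLine k i = -(1 / (k : ℝ)) := if_pos h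

theorem dumbbellLine_of_gt {k i : ℕ} (h : 2 * k < i) : dumbbellLine k i = k + 1 / (k : ℝ) := by
  rw [dumbbellLine, if_neg (by omega), if_neg (by omega)]

theorem exactOn_dumbbellLine (k : ℕ) : ExactOn (dumbbellLine k) k k (2 * k) := by
  intro j h1 h2
  rw [dumbbellLine, if_neg (by omega), if_pos h2]

theorem sorted_dumbbellLine (n k : ℕ) : Sorted n (dumbbellLine k) := by
  intro i j hij _
  have hk : 0 ≤ 1 / (k : ℝ) := by positivity
  have hij' : (i : ℝ) ≤ j := by exact_mod_cast hij
  rcases lt_or_ge i k with hi | hi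
  · rw [dumbbellLine_of_lt hi]
    rcases lt_or_ge j k with hj | hj
    · rw [dumbbellLine_of_lt hj]
    · rcases lt_or_ge (2 * k) j with hj' | hj'
      · rw [dumbbellLine_of_gt hj']
        have : (0 : ℝ) ≤ k := k.cast_nonneg
        linarith
      · rw [exactOn_dumbbellLine k j hj hj']
        have : (k : ℝ) ≤ j := by exact_mod_cast hj
        linarith
  · rcases lt_or_ge (2 * k) i with hi' | hi'
    · rw [dumbbellLine_of_gt hi', dumbbellLine_of_gt (by omega)]
    · rw [exactOn_dumbbellLine k i hi hi']
      rcases lt_or_ge (2 * k) j with hj' | hj'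
      · rw [dumbbellLine_of_gt hj']
        have : (i : ℝ) ≤ 2 * k := by exact_mod_cast hi'
        linarith
      · rw [exactOn_dumbbellLine k j (by omega) hj']
        linarith

/-- The controlled dumbbell after one step: the strategic agent at `2` has freed a group of three
agents around `2`. -/
structure AfterOneStep (k : ℕ) (x : ℕ → ℝ) : Prop where
  sorted : Sorted (3 * k + 1) x
  left : ∀ i < k, x i = -(1 / ((k : ℝ) + 1))
  joint : x k = 0
  low : x (k + 1) = 5 / 4
  mid : x (k + 2) = 2
  high : x (k + 3) = 11 / 4
  chain : ExactOn x k (k + 4) (2 * k)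
  right : ∀ i, 2 * k < i → i < 3 * k + 1 → x i = k + 1 / ((k : ℝ) + 1)

/-- The controlled dumbbell after two steps: the opinions in `almostEquidistantChain`, indexed by
natural numbers. -/
structure AfterTwoSteps (k : ℕ) (x : ℕ → ℝ) : Prop where
  sorted : Sorted (3 * k + 1) x
  left : ∀ i ≤ k, x i = -((k : ℝ) / ((k : ℝ) + 1) ^ 2)
  low : x (k + 1) = 13 / 8
  mid : x (k + 2) = 2
  high : x (k + 3) = 19 / 8
  first : x (k + 4) = 9 / 2
  chain : ExactOn x k (k + 5) (2 * k - 4)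
  low' : x (2 * k - 3) = k - 11 / 4
  mid' : x (2 * k - 2) = k - 2
  high' : x (2 * k - 1) = k - 5 / 4
  joint : x (2 * k) = k - 1 / (((k : ℝ) + 1) * ((k : ℝ) + 2))
  right : ∀ i, 2 * k < i → i < 3 * k + 1 → x i = k + (k : ℝ) / ((k : ℝ) + 1) ^ 2

theorem afterOneStep {k : ℕ} (hk : 10 ≤ k) {u : Fin 1 → ℝ} (hu : u 0 = 2) :
    AfterOneStep k (lineStep (3 * k + 1) (dumbbellLine k) u) := by
  have hkR : (10 : ℝ) ≤ k := by exact_mod_cast hk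
  have hs := sorted_dumbbellLine (3 * k + 1) k
  have hE := exactOn_dumbbellLine k
  have hk0 : 0 < 1 / (k : ℝ) := by positivity
  have hk1 : 1 / (k : ℝ) ≤ 1 / 10 := one_div_le_one_div_of_le (by norm_num) hkR
  have hu' : ∀ s, u s = 2 := fun s => by rw [Subsingleton.elim s 0, hu]
  have hL : ∀ i < k, dumbbellLine k i = -(1 / (k : ℝ)) := fun i hi => dumbbellLine_of_lt hi
  have hR : ∀ i, 2 * k < i → dumbbellLine k i = k + 1 / (k : ℝ) := fun i hi =>
    dumbbellLine_of_gt hi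
  have e0 := hE k le_rfl (by omega)
  have e1 := hE (k + 1) (by omega) (by omega)
  have e2 := hE (k + 2) (by omega) (by omega)
  have e3 := hE (k + 3) (by omega) (by omega)
  push_cast at e0 e1 e2 e3
  obtain ⟨c, hc⟩ : ∃ c, 2 * k = c + 3 := ⟨2 * k - 3, by omega⟩
  have hcR : 2 * (k : ℝ) = c + 3 := by exact_mod_cast hc
  have f1 := hE (c + 1) (by omega) (by omega)
  have f2 := hE (c + 2) (by omega) (by omega)
  have f3 := hE (c + 3) (by omega) (by omega)
  have f4 := hR (c + 4) (by omega)
  push_cast at f1 f2 f3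
  refine ⟨hs.lineStep, fun i hi => ?_, ?_, ?_, ?_, ?_, fun j hj1 hj2 => ?_, fun i hi hin => ?_⟩
  · rw [lineStep_left_cluster hs (by omega) hL (by linarith) (by linarith) hi, e0]
    · field_simp
      ring
    · intro s
      rw [hu', lt_abs]
      right; linarith
  · rw [lineStep_left_joint hs (by omega) hL (by linarith) (by linarith) (by linarith) (by omega),
      e0, e1]
    · field_simp
      ring
    · intro s
      rw [hu', lt_abs]
      right; linarith
  · rw [lineStep_eq_fourth hs (by omega) (by linarith) (by linarith) (Or.inr ?_)
      (Or.inr (by linarith)) (by rw [hu, e1, abs_le]; constructor <;> linarith), e0, e1, e2, hu]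
    · ring
    · rw [hL (k - 1) (by omega)]
      linarith
  · rw [hE.lineStep_eq_near hs (by omega) (a := k + 1) (by omega) (by omega)
      (by rw [hu, e2, abs_le]; constructor <;> linarith), hu]
    push_cast
    ring
  · rw [hE.lineStep_eq_near hs (by omega) (a := k + 2) (by omega) (by omega)
      (by rw [hu, e3, abs_le]; constructor <;> linarith), hu]
    push_cast
    ring
  · have hjR : (k : ℝ) + 4 ≤ j := by exact_mod_cast hj1
    have hfar : ∀ s, 1 < |dumbbellLine k j - u s| := by
      intro s
      rw [hu', hE j (by omega) hj2, lt_abs]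
      left; linarith
    rcases Nat.lt_or_ge (c + 1) j with hj3 | hj3
    · rcases (show j = c + 2 ∨ j = c + 3 by omega) with rfl | rfl
      · rw [lineStep_eq_third hs (by omega) (by linarith) (by linarith) (Or.inr ?_)
          (Or.inr (by linarith)) hfar, f1, f2, f3]
        · push_cast
          ring
        · have := hE c (by omega) (by omega)
          rw [show c + 1 - 1 = c by omega]
          linarith
      · rw [lineStep_right_joint hs (k := k) (v := k + 1 / (k : ℝ)) (by omega) (by omega) (by omega)
          (fun i hi _ => hR i (by omega)) (by linarith) (by linarith) ?_ hfar, f2, f3]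
        · have : (c : ℝ) = 2 * k - 3 := by linarith
          push_cast
          rw [this]
          field_simp
          ring
        · rw [show c + 2 - 1 = c + 1 by omega]
          linarith
    · obtain ⟨a, rfl⟩ : ∃ a, j = a + 1 := ⟨j - 1, by omega⟩
      exact hE.lineStep_eq hs (by omega) (by omega) (by omega) hfar
  · rw [lineStep_right_cluster hs (k := k) (a := c + 2) (v := k + 1 / (k : ℝ)) (by omega)
      (fun i hi _ => hR i (by omega)) (by linarith) (by linarith) (by omega) hin, f3]
    · rw [show (c : ℝ) + 3 - k = k by linarith]
      field_simp
      ring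
    · intro s
      rw [hu', lt_abs]
      left; linarith

theorem AfterOneStep.afterTwoSteps {k : ℕ} (hk : 10 ≤ k) {x : ℕ → ℝ} (h : AfterOneStep k x)
    {u : Fin 1 → ℝ} (hu : u 0 = k - 2) : AfterTwoSteps k (lineStep (3 * k + 1) x u) := by
  have hkR : (10 : ℝ) ≤ k := by exact_mod_cast hk
  have hs := h.sorted
  have hE := h.chain
  have hk0 : 0 < 1 / ((k : ℝ) + 1) := by positivity
  have hk1 : 1 / ((k : ℝ) + 1) ≤ 1 / 10 := one_div_le_one_div_of_le (by norm_num) (by linarith)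
  have hu' : ∀ s, u s = k - 2 := fun s => by rw [Subsingleton.elim s 0, hu]
  have hL := h.left
  have hR := h.right
  have e0 := h.joint
  have e1 := h.low
  have e2 := h.mid
  have e3 := h.high
  have e4 := hE (k + 4) (by omega) (by omega)
  have e5 := hE (k + 5) (by omega) (by omega)
  have e6 := hE (k + 6) (by omega) (by omega)
  have e7 := hE (k + 7) (by omega) (by omega)
  push_cast at e4 e5 e6 e7
  obtain ⟨c, hc⟩ : ∃ c, 2 * k = c + 3 := ⟨2 * k - 3, by omega⟩
  have hcR : 2 * (k : ℝ) = c + 3 := by exact_mod_cast hc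
  have f0 := hE c (by omega) (by omega)
  have f1 := hE (c + 1) (by omega) (by omega)
  have f2 := hE (c + 2) (by omega) (by omega)
  have f3 := hE (c + 3) (by omega) (by omega)
  have f4 := hR (c + 4) (by omega) (by omega)
  push_cast at f1 f2 f3
  have hlow : ∀ y : ℝ, y ≤ 6 → ∀ s, 1 < |y - u s| := by
    intro y hy s
    rw [hu', lt_abs]
    right; linarith
  refine ⟨hs.lineStep, fun i hi => ?_, ?_, ?_, ?_, ?_, fun j hj1 hj2 => ?_, ?_, ?_, ?_, ?_,
    fun i hi hin => ?_⟩
  · rcases hi.lt_or_eq with hi | rfl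
    · rw [lineStep_left_cluster hs (by omega) hL (by linarith) (by linarith) hi
        (hlow _ (by linarith)), e0]
      field_simp
      ring
    · have hN : nbrs (3 * i + 1) x i = Ico 0 (i + 1) := by
        refine nbrs_eq_Ico hs (Nat.zero_le _) (by omega) (by omega) ?_ (Or.inl rfl) ?_ (Or.inr ?_)
        · rw [hL 0 (by omega)]
          linarith
        · simp
        · linarith
      rw [lineStep_of_far (hlow _ (by linarith)), hN, sum_Ico_succ_top (by omega),
        sum_congr rfl fun j hj => hL j (mem_Ico.1 hj).2, e0]
      simp only [sum_const, Nat.card_Ico, nsmul_eq_mul, Nat.sub_zero]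
      push_cast
      field_simp
      ring
  · rw [lineStep_eq_half_left hs (by omega) (by linarith) (Or.inr ?_) (Or.inr ?_)
      (hlow _ (by linarith)), e1, e2]
    · norm_num
    · rw [Nat.add_sub_cancel]
      linarith
    · show 1 < x (k + 3) - _
      linarith
  · rw [lineStep_eq_third hs (a := k + 1) (by omega) ?_ ?_ (Or.inr ?_) (Or.inr ?_)
      (hlow _ ?_)]
    · show (x (k + 1) + x (k + 2) + x (k + 3)) / 3 = 2
      rw [e1, e2, e3]
      norm_num
    · show x (k + 2) - _ ≤ 1
      linarith
    · show x (k + 3) - x (k + 2) ≤ 1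
      linarith
    · show 1 < x (k + 2) - x k
      linarith
    · show 1 < x (k + 4) - x (k + 2)
      linarith
    · show x (k + 2) ≤ _
      linarith
  · rw [lineStep_eq_half_right hs (a := k + 2) (by omega) ?_ (Or.inr ?_) (Or.inr ?_)
      (hlow _ ?_)]
    · show (x (k + 2) + x (k + 3)) / 2 = 19 / 8
      rw [e2, e3]
      norm_num
    · show x (k + 3) - _ ≤ 1
      linarith
    · show 1 < x (k + 3) - x (k + 1)
      linarith
    · show 1 < x (k + 4) - x (k + 3)
      linarith
    · show x (k + 3) ≤ _
      linarith
  · rw [lineStep_eq_half_left hs (a := k + 4) (by omega) ?_ (Or.inr ?_) (Or.inr ?_)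
      (hlow _ (by linarith))]
    · show (x (k + 4) + x (k + 5)) / 2 = 9 / 2
      rw [e4, e5]
      linarith
    · show x (k + 5) - _ ≤ 1
      linarith
    · show 1 < _ - x (k + 3)
      linarith
    · show 1 < x (k + 6) - x (k + 4)
      linarith
  · rcases hj1.eq_or_lt with rfl | hj1
    · rw [lineStep_eq_third hs (a := k + 4) (by omega) ?_ ?_ (Or.inr ?_) (Or.inr ?_)
        (hlow _ ?_)]
      · show (x (k + 4) + x (k + 5) + x (k + 6)) / 3 = _
        rw [e4, e5, e6]
        push_cast
        ring
      · show x (k + 5) - _ ≤ 1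
        linarith
      · show x (k + 6) - x (k + 5) ≤ 1
        linarith
      · show 1 < x (k + 5) - x (k + 3)
        linarith
      · show 1 < x (k + 7) - x (k + 5)
        linarith
      · show x (k + 5) ≤ _
        linarith
    · obtain ⟨a, rfl⟩ : ∃ a, j = a + 1 := ⟨j - 1, by omega⟩
      refine hE.lineStep_eq hs (by omega) (by omega) (by omega) fun s => ?_
      have : ((a + 1 : ℕ) : ℝ) + 4 ≤ 2 * k := by
        have : a + 1 + 4 ≤ 2 * k := by omega
        exact_mod_cast this
      rw [hu', hE _ (by omega) (by omega), lt_abs]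
      right; linarith
  · obtain ⟨a, rfl⟩ : ∃ a, c = a + 1 := ⟨c - 1, by omega⟩
    push_cast at hcR
    rw [show 2 * k - 3 = a + 1 by omega, hE.lineStep_eq_near hs (by omega) (by omega) (by omega)
      (by rw [f0, hu, abs_le]; push_cast; constructor <;> linarith), hu]
    push_cast
    linarith
  · rw [show 2 * k - 2 = c + 1 by omega, hE.lineStep_eq_near hs (by omega) (by omega) (by omega)
      (by rw [f1, hu, abs_le]; constructor <;> linarith), hu]
    push_cast
    linarith
  · rw [show 2 * k - 1 = c + 1 + 1 by omega, lineStep_eq_fourth hs (by omega) ?_ ?_ (Or.inr ?_)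
      (Or.inr ?_) ?_]
    · show (x (c + 1) + x (c + 2) + x (c + 3) + u 0) / 4 = _
      rw [f1, f2, f3, hu]
      linarith
    · show x (c + 2) - _ ≤ 1
      linarith
    · show x (c + 3) - x (c + 2) ≤ 1
      linarith
    · show 1 < x (c + 2) - x c
      linarith
    · show 1 < x (c + 4) - x (c + 2)
      linarith
    · show |x (c + 2) - u 0| ≤ 1
      rw [f2, hu, abs_le]
      constructor <;> linarith
  · rw [show 2 * k = c + 2 + 1 by omega, lineStep_right_joint hs (k := k) (by omega) (by omega)
      (by omega) (fun i hi hin => hR i (by omega) hin) ?_ ?_ ?_ ?_]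
    · show (x (c + 2) + x (c + 3) + _) / _ = _
      rw [f2, f3]
      field_simp
      have : (c : ℝ) = 2 * k - 3 := by linarith
      rw [this]
      ring
    · show _ - x (c + 3) ≤ 1
      linarith
    · show x (c + 3) - _ ≤ 1
      linarith
    · show 1 < x (c + 3) - x (c + 1)
      linarith
    · intro s
      show 1 < |x (c + 3) - _|
      rw [f3, hu', lt_abs]
      left; linarith
  · rw [lineStep_right_cluster hs (k := k) (a := c + 2) (by omega)
      (fun i hi hin => hR i (by omega) hin) ?_ ?_ (by omega) hin ?_]
    · show (x (c + 3) + _) / _ = _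
      rw [f3, show (c : ℝ) + 3 - k = k by linarith]
      field_simp
      ring
    · show _ - x (c + 3) ≤ 1
      linarith
    · linarith
    · intro s
      rw [hu', lt_abs]
      left; linarith

theorem AfterTwoSteps.eq_almostEquidistantChain {k : ℕ} (hk : 10 ≤ k) {x : ℕ → ℝ}
    (h : AfterTwoSteps k x) :
    (fun i : Fin (3 * k + 1) => x i) = almostEquidistantChain k := by
  funext i
  obtain ⟨i, hi⟩ := i
  unfold almostEquidistantChain
  simp only
  split_ifs with h1 h2 h3 h4 h5 h6 h7 h8 h9 h10
  · exact h.left i h1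
  · rw [h2, h.low]
  · rw [h3, h.mid]
  · rw [h4, h.high]
  · rw [h5, h.first]
  · exact h.chain i (by omega) (by omega)
  · rw [show i = 2 * k - 3 by omega, h.low']
  · rw [show i = 2 * k - 2 by omega, h.mid']
  · rw [show i = 2 * k - 1 by omega, h.high']
  · rw [h10, h.joint]
  · exact h.right i (by omega) hi

theorem afterTwoSteps {k : ℕ} (hk : 10 ≤ k) {u : ℕ → Fin 1 → ℝ} (h0 : u 0 0 = 2)
    (h1 : u 1 0 = (k : ℝ) - 2) :
    AfterTwoSteps k (lineOpinions (3 * k + 1) (dumbbellLine k) u 2) :=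
  (afterOneStep hk h0).afterTwoSteps hk h1

/-! ### Cutting the chain into short pieces -/

/-- The strategy of the strategic agent: for `b + 1` rounds of two steps, opinion `D i + 2` at time
`2 i` and opinion `k - 2 - D i` at time `2 i + 1`. Afterwards it is out of everyone's sight. -/
noncomputable def cuttingControl (k D b t : ℕ) (_ : Fin 1) : ℝ :=
  if t < 2 * b + 2 then
    if t % 2 = 0 then (D : ℝ) * (t / 2 : ℕ) + 2 else (k : ℝ) - 2 - D * (t / 2 : ℕ)
  else 2 * k + 10

theorem cuttingControl_even {k D b i : ℕ} (hi : i ≤ b) (s : Fin 1) :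
    cuttingControl k D b (2 * i) s = D * i + 2 := by
  rw [cuttingControl, if_pos (by omega), if_pos (by omega), Nat.mul_div_cancel_left _ two_pos]

theorem cuttingControl_odd {k D b i : ℕ} (hi : i ≤ b) (s : Fin 1) :
    cuttingControl k D b (2 * i + 1) s = k - 2 - D * i := by
  rw [cuttingControl, if_pos (by omega), if_neg (by omega), show (2 * i + 1) / 2 = i by omega]

theorem cuttingControl_late {k D b t : ℕ} (ht : 2 * b + 2 ≤ t) (s : Fin 1) :
    cuttingControl k D b t s = 2 * k + 10 := by
  rw [cuttingControl, if_neg (by omega)]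

/-- What holds on both sides of the chain while it is being cut: the left group is in consensus,
the members of the right group see each other, and both groups are isolated. -/
structure Flanks (k : ℕ) (x : ℕ → ℝ) : Prop where
  sorted : Sorted (3 * k + 1) x
  le : ∀ i < 3 * k + 1, x i ≤ k + 1
  left : ∀ i ≤ k, x i = x 0
  right : ∀ i j, 2 * k ≤ i → i < 3 * k + 1 → 2 * k ≤ j → j < 3 * k + 1 → x j ≤ x i + 1
  cut_left : Cut (3 * k + 1) x (k + 1)
  cut_right : Cut (3 * k + 1) x (2 * k)

/-- The state after `s` rounds: the middle part of the chain is still exact, and the rest of it has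
been cut into pieces of `D` agents from either end. The exact part starts two agents inside the
innermost cuts, since the agents next to a cut start to move. -/
structure CutStage (k D s : ℕ) (x : ℕ → ℝ) : Prop extends Flanks k x where
  cut_low : ∀ i ≤ s, Cut (3 * k + 1) x (k + 4 + D * i)
  cut_high : ∀ i ≤ s, Cut (3 * k + 1) x (2 * k - 3 - D * i)
  exact : ExactOn x k (k + 6 + D * s) (2 * k - 5 - D * s)

/-- Strategic agents at the opinions of non-strategic ones do not bridge any cut. -/
theorem Cut.lineStep_of_eq {n p c : ℕ} {x : ℕ → ℝ} {u : Fin 1 → ℝ} (hx : Sorted n x)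
    (h : Cut n x c) (hp : p < n) (hu : u 0 = x p) : Cut n (HegselmannKrause.lineStep n x u) c := by
  refine h.lineStep hx fun h0 hn s => ?_
  rw [Subsingleton.elim s 0, hu]
  rcases Nat.lt_or_ge p c with h1 | h1
  · exact Or.inl (hx (by omega) (by omega))
  · exact Or.inr (Or.inl (hx h1 hp))

theorem Flanks.lineStep {k p : ℕ} {x : ℕ → ℝ} {u : Fin 1 → ℝ} (h : Flanks k x) (hp : p < 2 * k)
    (hu : u 0 = x p) : Flanks k (HegselmannKrause.lineStep (3 * k + 1) x u) where
  sorted := h.sorted.lineStep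
  le i hi := lineStep_le hi (fun j hj => h.le j (mem_nbrs.1 hj).1) fun s _ => by
    rw [Subsingleton.elim s 0, hu]
    exact h.le p (by omega)
  left i hi := lineStep_congr (by omega) (by omega) (h.left i hi)
  right i j hi hin hj hjn := by
    refine le_of_eq_of_le (lineStep_eq_of_block h.cut_right cut_self le_rfl
      (fun i j h1 h2 h3 h4 => h.right i j h1 h2 h3 h4) (fun i hi hin s => ?_) hj hjn hi hin)
      (by linarith)
    rw [Subsingleton.elim s 0, hu, lt_abs]
    have := h.cut_right hp hi hin
    left; linarith
  cut_left := h.cut_left.lineStep_of_eq h.sorted (by omega) hu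
  cut_right := h.cut_right.lineStep_of_eq h.sorted (by omega) hu

theorem AfterTwoSteps.cutStage {k D : ℕ} (hk : 10 ≤ k) {x : ℕ → ℝ} (h : AfterTwoSteps k x) :
    CutStage k D 0 x := by
  have hkR : (10 : ℝ) ≤ k := by exact_mod_cast hk
  have h1 : (k : ℝ) / ((k : ℝ) + 1) ^ 2 ≤ 1 / 10 := by
    rw [div_le_div_iff₀ (by positivity) (by norm_num)]
    nlinarith
  have h1' : 0 ≤ (k : ℝ) / ((k : ℝ) + 1) ^ 2 := by positivity
  have h2 : 1 / (((k : ℝ) + 1) * ((k : ℝ) + 2)) ≤ 1 / 10 := by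
    refine one_div_le_one_div_of_le (by norm_num) ?_
    nlinarith
  have h2' : 0 ≤ 1 / (((k : ℝ) + 1) * ((k : ℝ) + 2)) := by positivity
  have hs := h.sorted
  have hright : ∀ i, 2 * k ≤ i → i < 3 * k + 1 → (k : ℝ) - 1 / 10 ≤ x i ∧ x i ≤ k + 1 / 10 := by
    intro i hi hin
    rcases hi.eq_or_lt with rfl | hi
    · rw [h.joint]
      constructor <;> linarith
    · rw [h.right i hi hin]
      constructor <;> linarith
  refine ⟨⟨hs, fun i hi => ?_, fun i hi => ?_, fun i j hi hin hj hjn => ?_, ?_, ?_⟩, ?_, ?_, ?_⟩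
  · have := (hright (3 * k) (by omega) (by omega)).2
    have := hs (show i ≤ 3 * k by omega) (by omega)
    linarith
  · rw [h.left i hi, h.left 0 (by omega)]
  · have := hright i hi hin
    have := hright j hj hjn
    linarith
  · refine hs.cut (by omega) ?_
    rw [Nat.add_sub_cancel, h.left k le_rfl, h.low]
    linarith
  · refine hs.cut (by omega) ?_
    rw [h.high', h.joint]
    linarith
  · intro i hi
    obtain rfl : i = 0 := by omega
    refine hs.cut (by omega) ?_
    rw [Nat.mul_zero, Nat.add_zero, show k + 4 - 1 = k + 3 by omega, h.high, h.first]
    norm_num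
  · intro i hi
    obtain rfl : i = 0 := by omega
    refine hs.cut (by omega) ?_
    rw [Nat.mul_zero, Nat.sub_zero, show 2 * k - 3 - 1 = 2 * k - 4 by omega, h.low',
      h.chain _ (by omega) (by omega), Nat.cast_sub (by omega)]
    push_cast
    linarith
  · exact h.chain.mono (by omega) (by omega)

theorem CutStage.succ {k D s : ℕ} {x : ℕ → ℝ} {u u' : Fin 1 → ℝ} (h : CutStage k D s x)
    (hD : 10 ≤ D) (hs : 2 * (D * (s + 1)) + 10 ≤ k) (hu : u 0 = D * (s + 1 : ℕ) + 2)
    (hu' : u' 0 = k - 2 - D * (s + 1 : ℕ)) :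
    CutStage k D (s + 1) (lineStep (3 * k + 1) (lineStep (3 * k + 1) x u) u') := by
  have hDs : D * (s + 1) = D * s + D := Nat.mul_succ D s
  have hp : u 0 = x (k + 2 + D * (s + 1)) := by
    rw [hu, h.exact _ (by omega) (by omega)]
    push_cast
    ring
  obtain ⟨hl, hr, -, hcut⟩ := h.exact.cut_chain h.sorted (by omega) (by omega) (by omega) hp
  have hF := h.toFlanks.lineStep (by omega) hp
  have hq : u' 0 = lineStep (3 * k + 1) x u (2 * k - 2 - D * (s + 1)) := by
    rw [hu', hr _ (by omega) (by omega), Nat.cast_sub (by omega), Nat.cast_sub (by omega)]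
    push_cast
    ring
  obtain ⟨hl', -, hcut', -⟩ := hr.cut_chain hF.sorted (by omega) (by omega) (by omega) hq
  refine ⟨hF.lineStep (by omega) hq, fun i hi => ?_, fun i hi => ?_,
    hl'.mono (by omega) (by omega)⟩
  · refine Cut.lineStep_of_eq hF.sorted ?_ (by omega) hq
    rcases hi.eq_or_lt with rfl | hi
    · rwa [show k + 4 + D * (s + 1) = k + 2 + D * (s + 1) + 2 by omega]
    · exact (h.cut_low i (by omega)).lineStep_of_eq h.sorted (by omega) hp
  · rcases hi.eq_or_lt with rfl | hi
    · rwa [show 2 * k - 3 - D * (s + 1) = 2 * k - 2 - D * (s + 1) - 1 by omega]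
    · exact ((h.cut_high i (by omega)).lineStep_of_eq h.sorted (by omega) hp).lineStep_of_eq
        hF.sorted (by omega) hq

theorem cutStage_lineOpinions {k D b : ℕ} (hk : 10 ≤ k) (hD : 10 ≤ D)
    (hb : 2 * (D * b) + 10 ≤ k) {s : ℕ} (hs : s ≤ b) :
    CutStage k D s
      (lineOpinions (3 * k + 1) (dumbbellLine k) (cuttingControl k D b) (2 * s + 2)) := by
  induction s with
  | zero =>
    refine (afterTwoSteps hk ?_ ?_).cutStage hk
    · refine (cuttingControl_even (i := 0) (Nat.zero_le _) 0).trans ?_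
      simp
    · refine (cuttingControl_odd (i := 0) (Nat.zero_le _) 0).trans ?_
      simp
  | succ s ih =>
    have hm : D * (s + 1) ≤ D * b := Nat.mul_le_mul_left D hs
    exact (ih (by omega)).succ hD (by omega) (cuttingControl_even (i := s + 1) hs 0)
      (cuttingControl_odd (i := s + 1) hs 0)

/-- Without control, a chain that has been cut into short pieces is resolved quickly. -/
theorem CutStage.resolved {S : Type*} [Fintype S] {k D b T : ℕ} {X : ℕ → ℕ → ℝ} {u : ℕ → S → ℝ}
    (hX : FreeOrbit (3 * k + 1) X u) (h : CutStage k D b (X 0)) (hk : 10 ≤ k)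
    (hb : 2 * (D * b) + 10 ≤ k) (hb' : k < 2 * (D * (b + 1)) + 10)
    (hT : 4 * (2 * D + 3) ^ 3 ≤ T) : Resolved (X T) 0 (3 * k + 1) := by
  have hT' : 0 + 4 * (2 * D + 3) ^ 3 ≤ T := by omega
  have hT1 : 0 + 1 ≤ T := by
    have : 0 < (2 * D + 3) ^ 3 := by positivity
    omega
  have hDb : D * (b + 1) = D * b + D := Nat.mul_succ D b
  have hcut : ∀ {c}, Cut (3 * k + 1) (X 0) c → Cut (3 * k + 1) (X T) c :=
    fun hc => hX.cut_of_le (Nat.zero_le T) hc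
  have hpiece : ∀ {c c'}, Cut (3 * k + 1) (X 0) c → Cut (3 * k + 1) (X 0) c' → c ≤ c' →
      c' ≤ c + (2 * D + 3) → c' ≤ 3 * k + 1 → Resolved (X T) c c' := by
    intro c c' hc hc' h1 h2 h3
    exact hX.resolved_of_card hT' (c' - c) (by omega) (by omega) hc hc' h3
  have hleft : Resolved (X T) 0 (k + 1) := fun i j _ hij hj =>
    Or.inl (hX.eq_of_le (Nat.zero_le T) (by omega) (by omega)
      ((h.left i (by omega)).trans (h.left j (by omega)).symm))
  have hright : Resolved (X T) (2 * k) (3 * k + 1) :=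
    hX.resolved_of_le_one h.cut_right cut_self le_rfl
      (h.right _ _ le_rfl (by omega) (by omega) (by omega)) hT1
  have hlow : ∀ i ≤ b, Resolved (X T) 0 (k + 4 + D * i) := by
    intro i hi
    induction i with
    | zero =>
      exact hleft.append (hpiece h.cut_left (h.cut_low 0 (Nat.zero_le _)) (by omega) (by omega)
        (by omega)) (hcut h.cut_left) (by omega)
    | succ i ih =>
      have h1 : D * (i + 1) = D * i + D := Nat.mul_succ D i
      have h2 : D * (i + 1) ≤ D * b := Nat.mul_le_mul_left D hi
      have hc := h.cut_low i (by omega)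
      exact (ih (by omega)).append (hpiece hc (h.cut_low _ hi) (by omega) (by omega) (by omega))
        (hcut hc) (by omega)
  have hhigh : ∀ i ≤ b, Resolved (X T) (2 * k - 3 - D * i) (3 * k + 1) := by
    intro i hi
    induction i with
    | zero =>
      exact (hpiece (h.cut_high 0 (Nat.zero_le _)) h.cut_right (by omega) (by omega)
        (by omega)).append hright (hcut h.cut_right) le_rfl
    | succ i ih =>
      have h1 : D * (i + 1) = D * i + D := Nat.mul_succ D i
      have h2 : D * (i + 1) ≤ D * b := Nat.mul_le_mul_left D hi
      have hc := h.cut_high i (by omega)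
      exact (hpiece (h.cut_high _ hi) hc (by omega) (by omega) (by omega)).append
        (ih (by omega)) (hcut hc) le_rfl
  have hc := h.cut_low b le_rfl
  have hc' := h.cut_high b le_rfl
  exact ((hlow b le_rfl).append (hpiece hc hc' (by omega) (by omega) (by omega)) (hcut hc)
    (by omega)).append (hhigh b le_rfl) (hcut hc') le_rfl

/-- After the last round, the strategic agent is out of sight. -/
theorem freeOrbit_cuttingControl {k D b : ℕ} (hk : 10 ≤ k) (hD : 10 ≤ D)
    (hb : 2 * (D * b) + 10 ≤ k) :
    FreeOrbit (3 * k + 1)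
      (fun t => lineOpinions (3 * k + 1) (dumbbellLine k) (cuttingControl k D b) (2 * b + 2 + t))
      (fun t => cuttingControl k D b (2 * b + 2 + t)) := by
  have hstage := cutStage_lineOpinions hk hD hb le_rfl
  have hle : ∀ t, ∀ i < 3 * k + 1, lineOpinions (3 * k + 1) (dumbbellLine k)
      (cuttingControl k D b) (2 * b + 2 + t) i ≤ k + 1 := by
    intro t
    induction t with
    | zero => exact hstage.le
    | succ t ih =>
      intro i hi
      refine lineStep_le hi (fun j hj => ih j (mem_nbrs.1 hj).1) fun s hs => ?_
      rw [mem_ctrls, Nat.add_eq, cuttingControl_late (by omega), abs_le] at hs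
      have := ih i hi
      have : (0 : ℝ) ≤ k := k.cast_nonneg
      linarith
  refine ⟨fun t => rfl, fun t i hi s => ?_, hstage.sorted⟩
  rw [cuttingControl_late (by omega), lt_abs]
  have := hle t i hi
  have : (0 : ℝ) ≤ k := k.cast_nonneg
  right; linarith

/-- The time that the strategy takes, in terms of the length `D` of the pieces. -/
theorem converged_cuttingControl {k D b : ℕ} (hk : 10 ≤ k) (hD : 10 ≤ D)
    (hb : 2 * (D * b) + 10 ≤ k) (hb' : k < 2 * (D * (b + 1)) + 10) :
    Converged (opinions (dumbbell k) (cuttingControl k D b)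
      (2 * b + 2 + 4 * (2 * D + 3) ^ 3)) := by
  rw [dumbbell_eq, opinions_eq_lineOpinions]
  exact (CutStage.resolved (freeOrbit_cuttingControl hk hD hb)
    (cutStage_lineOpinions hk hD hb le_rfl) hk hb hb' le_rfl).converged

theorem convergenceTime_le {N S : Type*} [Fintype N] [Fintype S] {x₀ : N → ℝ} {u : ℕ → S → ℝ}
    {t : ℕ} (h : Converged (opinions x₀ u t)) : convergenceTime x₀ u ≤ t :=
  iInf₂_le t h

/-- Pieces of about `k ^ (1 / 4)` agents balance the number of rounds, which is about
`k ^ (3 / 4)`, with the cubic bound for the time in which the pieces are resolved. -/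
theorem exists_optimalConvergenceTime_le : ∃ C : ℝ, 0 < C ∧ ∀ k : ℕ, 10 ≤ k → ∃ T : ℕ,
    optimalConvergenceTime (dumbbell k) 1 = (T : ℕ∞) ∧
      (T : ℝ) ≤ C * ((3 * k + 1 : ℕ) : ℝ) ^ (3 / 4 : ℝ) := by
  refine ⟨100000, by norm_num, fun k hk => ?_⟩
  have hkR : (10 : ℝ) ≤ k := by exact_mod_cast hk
  set r : ℝ := (k : ℝ) ^ (1 / 4 : ℝ) with hr
  have hr1 : 1 ≤ r := Real.one_le_rpow (by linarith) (by norm_num)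
  have hr4 : r ^ 4 = k := by
    rw [hr, ← Real.rpow_natCast, ← Real.rpow_mul (by positivity)]
    norm_num
  have hr3 : r ^ 3 = (k : ℝ) ^ (3 / 4 : ℝ) := by
    rw [hr, ← Real.rpow_natCast, ← Real.rpow_mul (by positivity)]
    norm_num
  set D : ℕ := ⌈r⌉₊ + 10 with hD
  have hDr : r ≤ D := by
    rw [hD]
    push_cast
    linarith [Nat.le_ceil r]
  have hDr' : (D : ℝ) ≤ 12 * r := by
    rw [hD]
    push_cast
    linarith [Nat.ceil_lt_add_one (show 0 ≤ r by linarith)]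
  set b : ℕ := (k - 10) / (2 * D) with hbdef
  have hb : 2 * (D * b) + 10 ≤ k := by
    have := Nat.div_mul_le_self (k - 10) (2 * D)
    rw [← hbdef] at this
    have h2 : b * (2 * D) = 2 * (D * b) := by ring
    omega
  have hb' : k < 2 * (D * (b + 1)) + 10 := by
    have := Nat.lt_div_mul_add (a := k - 10) (show 0 < 2 * D by omega)
    rw [← hbdef] at this
    have h2 : b * (2 * D) + 2 * D = 2 * (D * (b + 1)) := by ring
    omega
  have hle : optimalConvergenceTime (dumbbell k) 1 ≤
      ((2 * b + 2 + 4 * (2 * D + 3) ^ 3 : ℕ) : ℕ∞) :=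
    (iInf_le _ (cuttingControl k D b)).trans
      (convergenceTime_le (converged_cuttingControl hk (by omega) hb hb'))
  obtain ⟨T, hT⟩ := ENat.ne_top_iff_exists.1 (ne_top_of_le_ne_top (ENat.natCast_ne_top _) hle)
  refine ⟨T, hT.symm, ?_⟩
  rw [← hT, ENat.natCast_le_natCast] at hle
  have hTR : (T : ℝ) ≤ 2 * b + 2 + 4 * (2 * D + 3) ^ 3 := by exact_mod_cast hle
  have hbr : 2 * (b : ℝ) ≤ r ^ 3 := by
    have h1 : 2 * ((D : ℝ) * b) + 10 ≤ k := by exact_mod_cast hb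
    have h2 : r * b ≤ D * b := by gcongr
    have h3 : r * (2 * b) ≤ r * r ^ 3 := by
      calc r * (2 * b) ≤ k := by linarith
        _ = r * r ^ 3 := by rw [← hr4]; ring
    exact le_of_mul_le_mul_left h3 (by linarith)
  have hmr : (2 * (D : ℝ) + 3) ^ 3 ≤ (27 * r) ^ 3 := by
    gcongr
    linarith
  have hr31 : 1 ≤ r ^ 3 := one_le_pow₀ hr1
  have hn : r ^ 3 ≤ ((3 * k + 1 : ℕ) : ℝ) ^ (3 / 4 : ℝ) := by
    rw [hr3]
    refine Real.rpow_le_rpow (by positivity) ?_ (by norm_num)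
    push_cast
    linarith
  calc (T : ℝ) ≤ r ^ 3 + 2 * r ^ 3 + 4 * (27 * r) ^ 3 := by linarith
    _ = 78735 * r ^ 3 := by ring
    _ ≤ 100000 * r ^ 3 := by linarith
    _ ≤ _ := by gcongr

/-! ### The uncontrolled dumbbell -/

/-- The absence of strategic agents. -/
noncomputable def noControl (_ : ℕ) (s : Fin 0) : ℝ := s.elim0

/-- The free dynamics commute with reflections of the line. -/
theorem lineStep_reflect {n : ℕ} {x : ℕ → ℝ} {K : ℝ} (u : Fin 0 → ℝ)
    (h : ∀ i < n, x (n - 1 - i) = K - x i) {i : ℕ} (hi : i < n) :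
    lineStep n x u (n - 1 - i) = K - lineStep n x u i := by
  have hmem : ∀ {i j}, i < n → j ∈ nbrs n x i → n - 1 - j ∈ nbrs n x (n - 1 - i) := by
    intro i j hi hj
    rw [mem_nbrs] at hj ⊢
    refine ⟨by omega, ?_⟩
    rw [h i hi, h j hj.1, show K - x i - (K - x j) = -(x i - x j) by ring, abs_neg]
    exact hj.2
  have hmem' : ∀ j ∈ nbrs n x (n - 1 - i), n - 1 - j ∈ nbrs n x i := by
    intro j hj
    have := hmem (by omega) hj
    rwa [show n - 1 - (n - 1 - i) = i by omega] at this
  have hinv : ∀ i, ∀ j ∈ nbrs n x i, n - 1 - (n - 1 - j) = j := by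
    intro i j hj
    have := (mem_nbrs.1 hj).1
    omega
  have hcard : #(nbrs n x (n - 1 - i)) = #(nbrs n x i) :=
    card_nbij' (fun j => n - 1 - j) (fun j => n - 1 - j) hmem' (fun j hj => hmem hi hj)
      (hinv _) (hinv _)
  have hsum : ∑ j ∈ nbrs n x (n - 1 - i), x j = ∑ j ∈ nbrs n x i, (K - x j) :=
    sum_nbij' (fun j => n - 1 - j) (fun j => n - 1 - j) hmem' (fun j hj => hmem hi hj)
      (hinv _) (hinv _) fun j hj => by rw [h j (mem_nbrs.1 hj).1]; ring
  have hpos : (#(nbrs n x i) : ℝ) ≠ 0 := by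
    exact_mod_cast (card_pos.2 ⟨i, self_mem_nbrs hi⟩).ne'
  rw [lineStep_of_far fun s => s.elim0, lineStep_of_far fun s => s.elim0, hsum, hcard,
    sum_sub_distrib, sum_const, nsmul_eq_mul, sub_div, mul_div_cancel_left₀ _ hpos]

/-- A truncated parabola. -/
noncomputable def truncSq (R y : ℝ) : ℝ := (max 0 (R - y)) ^ 2

theorem truncSq_nonneg (R y : ℝ) : 0 ≤ truncSq R y := sq_nonneg _

theorem truncSq_le {R y : ℝ} (hR : 0 ≤ R) (hy : 0 ≤ y) : truncSq R y ≤ R ^ 2 :=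
  pow_le_pow_left₀ (le_max_left _ _) (max_le hR (by linarith)) 2

theorem truncSq_of_le {R y : ℝ} (h : R ≤ y) : truncSq R y = 0 := by
  rw [truncSq, max_eq_left (by linarith)]
  norm_num

theorem truncSq_add_truncSq_le (R y : ℝ) :
    truncSq R (y - 1) + truncSq R (y + 1) ≤ 2 * truncSq R y + 2 := by
  unfold truncSq
  -- The second difference of a parabola is `2`, and truncation does not increase it.
  rcases max_cases 0 (R - (y - 1)) with ⟨h1, h1'⟩ | ⟨h1, h1'⟩ <;>
  rcases max_cases 0 (R - (y + 1)) with ⟨h2, h2'⟩ | ⟨h2, h2'⟩ <;>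
  rcases max_cases 0 (R - y) with ⟨h3, h3'⟩ | ⟨h3, h3'⟩ <;>
  rw [h1, h2, h3] <;> nlinarith

theorem truncSq_zero_sub_le {R : ℝ} (hR : 0 ≤ R) : 2 * R ≤ truncSq R 0 - truncSq R 1 + 4 := by
  unfold truncSq
  rw [sub_zero, max_eq_right hR]
  rcases max_cases 0 (R - 1) with ⟨h, h'⟩ | ⟨h, h'⟩ <;> rw [h] <;> nlinarith

/-- An upper bound for the amount by which the `y`-th distance in the chain falls short of `1` at
time `t`. It is a supersolution of the heat equation that governs these deficits; its slope at
either end is steep enough to absorb what flows in from the clusters. The support `k / 40` of the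
parabolas is so short that a slope of this size keeps the value below `1 / (2 k)`; the factor `180`
then makes the flow at the ends `3 / k²`. The term `4 t / 3` is twice the `2 t / 3` that each of
the two parabolas needs. -/
noncomputable def barrier (k : ℕ) (t y : ℝ) : ℝ :=
  180 / (k : ℝ) ^ 3 * (truncSq (k / 40) y + truncSq (k / 40) (k - 1 - y) + 4 / 3 * t)

theorem barrier_nonneg {k : ℕ} {t y : ℝ} (ht : 0 ≤ t) : 0 ≤ barrier k t y := by
  have h1 := truncSq_nonneg (k / 40) y
  have h2 := truncSq_nonneg (k / 40) (k - 1 - y)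
  unfold barrier
  positivity

theorem barrier_reflect (k : ℕ) (t y : ℝ) : barrier k t (k - 1 - y) = barrier k t y := by
  unfold barrier
  rw [show (k : ℝ) - 1 - (k - 1 - y) = y by ring, add_comm (truncSq _ (k - 1 - y))]

theorem barrier_le {k : ℕ} (hk : 10 ≤ k) {t y : ℝ} (ht : t ≤ (k : ℝ) ^ 2 / 1000) (hy : 0 ≤ y)
    (hy' : y ≤ k - 1) : barrier k t y ≤ 1 / (2 * k) := by
  have hkR : (10 : ℝ) ≤ k := by exact_mod_cast hk
  have h1 := truncSq_le (R := (k : ℝ) / 40) (by positivity) hy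
  have h2 := truncSq_le (R := (k : ℝ) / 40) (y := k - 1 - y) (by positivity) (by linarith)
  unfold barrier
  rw [div_mul_eq_mul_div, div_le_div_iff₀ (by positivity) (by positivity)]
  have h3 : 180 * (truncSq (k / 40) y + truncSq (k / 40) (k - 1 - y) + 4 / 3 * t) ≤
      (k : ℝ) ^ 2 / 2 := by
    nlinarith
  nlinarith

theorem barrier_interior {k : ℕ} (t y : ℝ) :
    (barrier k t (y - 1) + barrier k t y + barrier k t (y + 1)) / 3 ≤ barrier k (t + 1) y := by
  have h1 := truncSq_add_truncSq_le (k / 40) y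
  have h2 := truncSq_add_truncSq_le (k / 40) (k - 1 - y)
  unfold barrier
  rw [← mul_add, ← mul_add, mul_div_assoc]
  refine mul_le_mul_of_nonneg_left ?_ (by positivity)
  rw [show (k : ℝ) - 1 - (y - 1) = k - 1 - y + 1 by ring,
    show (k : ℝ) - 1 - (y + 1) = k - 1 - y - 1 by ring]
  linarith

theorem barrier_boundary {k : ℕ} (hk : 10 ≤ k) (t : ℝ) :
    (2 * barrier k t 0 + barrier k t 1) / 3 + 3 / (k : ℝ) ^ 2 ≤ barrier k (t + 1) 0 := by
  have hkR : (10 : ℝ) ≤ k := by exact_mod_cast hk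
  have h1 := truncSq_zero_sub_le (R := (k : ℝ) / 40) (by positivity)
  have h2 : 3 / (k : ℝ) ^ 2 = 180 / (k : ℝ) ^ 3 * (k / 60) := by
    field_simp
    norm_num
  unfold barrier
  rw [truncSq_of_le (show (k : ℝ) / 40 ≤ k - 1 - 0 by linarith),
    truncSq_of_le (show (k : ℝ) / 40 ≤ k - 1 - 1 by linarith), h2, ← sub_nonneg]
  have h3 : 0 ≤ 180 / (k : ℝ) ^ 3 * ((truncSq (k / 40) 0 - truncSq (k / 40) 1 + 4 -
      2 * (k / 40)) / 3) :=
    mul_nonneg (by positivity) (by linarith)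
  linarith

/-- The shape of the uncontrolled dumbbell while its neighbourhoods are the original ones: two
clusters, mirror images of each other, joined by a chain whose distances are at most `1`, but not
much less. -/
structure IsDumbbell (k : ℕ) (t : ℝ) (x : ℕ → ℝ) : Prop where
  sorted : Sorted (3 * k + 1) x
  reflect : ∀ i < 3 * k + 1, x (3 * k - i) = k - x i
  left : ∀ i < k, x i = x 0
  le_gap : (1 - 1 / (2 * (k : ℝ))) / (k + 2) ≤ x k - x 0
  gap_le : x k - x 0 ≤ 1 / k
  dist_le : ∀ i < k, x (k + i + 1) - x (k + i) ≤ 1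
  le_dist : ∀ i < k, 1 - (x (k + i + 1) - x (k + i)) ≤ barrier k t i

theorem isDumbbell_dumbbellLine {k : ℕ} (hk : 10 ≤ k) : IsDumbbell k 0 (dumbbellLine k) := by
  have hkR : (10 : ℝ) ≤ k := by exact_mod_cast hk
  have hE := exactOn_dumbbellLine k
  have hgap : dumbbellLine k k - dumbbellLine k 0 = 1 / k := by
    rw [hE k le_rfl (by omega), dumbbellLine_of_lt (by omega)]
    ring
  have hd : ∀ i < k, dumbbellLine k (k + i + 1) - dumbbellLine k (k + i) = 1 := by
    intro i hi
    rw [hE _ (by omega) (by omega), hE _ (by omega) (by omega)]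
    push_cast
    ring
  refine ⟨sorted_dumbbellLine _ _, fun i hi => ?_, fun i hi => ?_, ?_, hgap.le,
    fun i hi => (hd i hi).le, fun i hi => ?_⟩
  · rcases lt_or_ge i k with h1 | h1
    · rw [dumbbellLine_of_lt h1, dumbbellLine_of_gt (by omega)]
      ring
    · rcases lt_or_ge (2 * k) i with h2 | h2
      · rw [dumbbellLine_of_lt (by omega), dumbbellLine_of_gt h2]
        ring
      · rw [hE i h1 h2, hE _ (by omega) (by omega), Nat.cast_sub (by omega)]
        push_cast
        ring
  · rw [dumbbellLine_of_lt hi, dumbbellLine_of_lt (by omega)]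
  · rw [hgap]
    have : 0 < 1 / (2 * (k : ℝ)) := by positivity
    gcongr <;> linarith
  · rw [hd i hi, sub_self]
    exact barrier_nonneg le_rfl

/-- The shape persists for as long as the barrier stays below the distance between the clusters and
their neighbours in the chain. -/
theorem IsDumbbell.succ {k : ℕ} {t : ℝ} {x : ℕ → ℝ} (hk : 10 ≤ k) (h : IsDumbbell k t x)
    (ht : t ≤ (k : ℝ) ^ 2 / 1000) (u : Fin 0 → ℝ) :
    IsDumbbell k (t + 1) (lineStep (3 * k + 1) x u) := by
  have hkR : (10 : ℝ) ≤ k := by exact_mod_cast hk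
  have hs := h.sorted
  have hsmall : ∀ i < k, 1 - (x (k + i + 1) - x (k + i)) ≤ 1 / (2 * k) := fun i hi => by
    refine (h.le_dist i hi).trans (barrier_le hk ht i.cast_nonneg ?_)
    have : (i : ℝ) + 1 ≤ k := by exact_mod_cast hi
    linarith
  have hk2 : 1 / (2 * (k : ℝ)) ≤ 1 / 20 := one_div_le_one_div_of_le (by norm_num) (by linarith)
  have hk1 : 1 / (k : ℝ) ≤ 1 / 10 := one_div_le_one_div_of_le (by norm_num) hkR
  have hg := h.gap_le
  have hg' := h.le_gap
  have hgap : 1 / (2 * (k : ℝ)) < x k - x 0 := by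
    refine lt_of_lt_of_le ?_ hg'
    rw [lt_div_iff₀ (by linarith), div_mul_eq_mul_div, div_lt_iff₀ (by positivity), sub_mul,
      div_mul_cancel₀ _ (by positivity)]
    linarith
  have hs0 := hsmall 0 (by omega)
  have hs1 := hsmall 1 (by omega)
  have hd0 := h.dist_le 0 (by omega)
  have hd1 := h.dist_le 1 (by omega)
  simp only [Nat.add_zero] at hs0 hd0
  have hfar : ∀ (i : ℕ) (s : Fin 0), 1 < |x i - u s| := fun i s => s.elim0
  -- One step, explicitly.
  have hcluster : ∀ i < k, lineStep (3 * k + 1) x u i = (k * x 0 + x k) / (k + 1) := fun i hi =>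
    lineStep_left_cluster hs (by omega) h.left (by linarith) (by linarith) hi fun s => s.elim0
  have hjoint : lineStep (3 * k + 1) x u k = (k * x 0 + x k + x (k + 1)) / (k + 2) :=
    lineStep_left_joint hs (by omega) h.left (by linarith) hd0
      (by rw [show k + 2 = k + 1 + 1 from rfl]; linarith) (by omega) (hfar k)
  have hchain : ∀ i, i + 1 < k →
      lineStep (3 * k + 1) x u (k + i + 1) = (x (k + i) + x (k + i + 1) + x (k + i + 2)) / 3 := by
    intro i hi
    refine lineStep_eq_third hs (by omega) (h.dist_le i (by omega)) (h.dist_le (i + 1) hi)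
      (Or.inr ?_) (Or.inr ?_) (hfar _)
    · rcases Nat.eq_zero_or_pos i with rfl | hi0
      · simp only [Nat.add_zero]
        rw [h.left (k - 1) (by omega)]
        linarith
      · obtain ⟨i, rfl⟩ : ∃ c, i = c + 1 := ⟨i - 1, by omega⟩
        have h1 := hsmall i (by omega)
        have h2 := hsmall (i + 1) (by omega)
        rw [show k + (i + 1) - 1 = k + i by omega]
        rw [← add_assoc] at h2 ⊢
        linarith
    · have h1 := hsmall (i + 1) hi
      rw [show k + (i + 1) = k + i + 1 by omega] at h1
      show 1 < x (k + i + 1 + 1 + 1) - x (k + i + 1)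
      rcases (show i + 2 < k ∨ i + 2 = k by omega) with hi2 | hi2
      · have h2 := hsmall (i + 2) hi2
        rw [show k + (i + 2) = k + i + 1 + 1 by omega] at h2
        linarith
      · have h3 := h.reflect (k - 1) (by omega)
        have h4 := h.reflect (k + 1) (by omega)
        rw [show 3 * k - (k - 1) = k + i + 1 + 1 + 1 by omega, h.left (k - 1) (by omega)] at h3
        rw [show 3 * k - (k + 1) = k + i + 1 by omega] at h4
        linarith
  have hreflect : ∀ i < 3 * k + 1,
      lineStep (3 * k + 1) x u (3 * k - i) = k - lineStep (3 * k + 1) x u i :=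
    fun i hi => lineStep_reflect u h.reflect hi
  set x' := lineStep (3 * k + 1) x u with hx'
  have h0 := hcluster 0 (by omega)
  set g := x k - x 0 with hgdef
  set δ := 1 - (x (k + 1) - x k) with hδ
  have hδ0 : 0 ≤ δ := by linarith
  have hgap' : x' k - x' 0 = g * k / ((k + 1) * (k + 2)) + (1 - δ) / (k + 2) := by
    rw [hjoint, h0, hgdef, hδ]
    field_simp
    ring
  have hg0 : 0 < g := by
    refine lt_trans ?_ hgap
    positivity
  -- The first distance of the chain: its deficit is fed by the cluster.
  have hfirst : 1 - (x' (k + 1) - x' k) =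
      (2 * δ + (1 - (x (k + 1 + 1) - x (k + 1)))) / 3 + (1 - k * g - δ) / (k + 2) := by
    have := hchain 0 (by omega)
    simp only [Nat.add_zero] at this
    rw [this, hjoint, hgdef, hδ, show k + 2 = k + 1 + 1 from rfl]
    field_simp
    ring
  have hkg : k * g ≤ 1 := by
    calc (k : ℝ) * g ≤ k * (1 / k) := by gcongr
      _ = 1 := by field_simp
  have hfirst0 : 0 ≤ 1 - (x' (k + 1) - x' k) := by
    rw [hfirst]
    have h1 : δ / (k + 2) ≤ δ / 3 := by gcongr; linarith
    have h2 : 0 ≤ (1 - k * g) / (k + 2) := div_nonneg (by linarith) (by positivity)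
    have h3 : (1 - k * g - δ) / (k + 2) = (1 - k * g) / (k + 2) - δ / (k + 2) := by ring
    linarith
  have hfirst1 : 1 - (x' (k + 1) - x' k) ≤ barrier k (t + 1) 0 := by
    refine le_trans ?_ (barrier_boundary hk t)
    rw [hfirst]
    have h1 := h.le_dist 0 (by omega)
    have h2 := h.le_dist 1 (by omega)
    simp only [Nat.add_zero, Nat.cast_zero, Nat.cast_one] at h1 h2
    have h3 : (1 - k * g - δ) / (k + 2) ≤ 3 / (k : ℝ) ^ 2 := by
      have h4 : (1 - 1 / (2 * (k : ℝ))) ≤ g * (k + 2) := (div_le_iff₀ (by positivity)).1 hg'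
      have h5 : 1 - k * g - δ ≤ 3 / k := by
        have h6 : (2 : ℝ) * (1 / k) = 2 / k := by ring
        have h7 : (1 : ℝ) / (2 * k) = 1 / 2 / k := by field_simp
        have h8 : (3 : ℝ) / k = 2 / k + 1 / 2 / k + 1 / 2 / k := by ring
        have h9 : (0 : ℝ) < 1 / 2 / k := by positivity
        linarith
      calc (1 - k * g - δ) / (k + 2) ≤ (3 / k) / (k + 2) := by gcongr
        _ ≤ (3 / k) / k := by
          gcongr
          linarith
        _ = 3 / (k : ℝ) ^ 2 := by rw [div_div, sq]
    linarith
  -- The remaining distances.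
  have hdist : ∀ i < k, 0 ≤ 1 - (x' (k + i + 1) - x' (k + i)) ∧
      1 - (x' (k + i + 1) - x' (k + i)) ≤ barrier k (t + 1) i := by
    intro i hi
    rcases Nat.eq_zero_or_pos i with rfl | hi0
    · simp only [Nat.add_zero, Nat.cast_zero]
      exact ⟨hfirst0, hfirst1⟩
    rcases (show i + 1 < k ∨ i + 1 = k by omega) with hi1 | hi1
    · obtain ⟨i, rfl⟩ : ∃ c, i = c + 1 := ⟨i - 1, by omega⟩
      have h1 := hchain i (by omega)
      have h2 := hchain (i + 1) (by omega)
      have d1 := h.dist_le i (by omega)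
      have d2 := h.dist_le (i + 1) (by omega)
      have d3 := h.dist_le (i + 1 + 1) (by omega)
      have b1 := h.le_dist i (by omega)
      have b2 := h.le_dist (i + 1) (by omega)
      have b3 := h.le_dist (i + 1 + 1) (by omega)
      have hb := barrier_interior (k := k) t ((i + 1 : ℕ) : ℝ)
      push_cast at b1 b2 b3 hb ⊢
      rw [add_sub_cancel_right] at hb
      simp only [← add_assoc] at *
      rw [h1, h2]
      constructor <;> linarith
    · have h1 := hreflect k (by omega)
      have h2 := hreflect (k + 1) (by omega)
      rw [show 3 * k - k = k + i + 1 by omega] at h1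
      rw [show 3 * k - (k + 1) = k + i by omega] at h2
      have h3 : (i : ℝ) = k - 1 - 0 := by
        have : (i : ℝ) + 1 = k := by exact_mod_cast hi1
        linarith
      rw [h1, h2, h3, barrier_reflect]
      constructor <;> linarith
  refine ⟨hs.lineStep, hreflect, fun i hi => by rw [hcluster i hi, h0], ?_, ?_,
    fun i hi => by linarith [(hdist i hi).1], fun i hi => (hdist i hi).2⟩
  · rw [hgap']
    have h1 : 0 ≤ g * k / ((k + 1) * (k + 2)) := by positivity
    have h2 : (1 - 1 / (2 * (k : ℝ))) / (k + 2) ≤ (1 - δ) / (k + 2) := by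
      gcongr
    linarith
  · rw [hgap']
    have h1 : g * k / ((k + 1) * (k + 2)) ≤ 1 / ((k + 1) * (k + 2)) := by
      gcongr
      linarith
    have h2 : (1 - δ) / (k + 2) ≤ 1 / (k + 2) := by
      gcongr
      linarith
    have h3 : 1 / (((k : ℝ) + 1) * (k + 2)) + 1 / (k + 2) = 1 / (k + 1) := by
      field_simp
      ring
    have h4 : 1 / ((k : ℝ) + 1) ≤ 1 / k := by
      gcongr
      linarith
    linarith

theorem isDumbbell_lineOpinions {k : ℕ} (hk : 10 ≤ k) {t : ℕ} (ht : (t : ℝ) ≤ (k : ℝ) ^ 2 / 1000) :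
    IsDumbbell k t (lineOpinions (3 * k + 1) (dumbbellLine k) noControl t) := by
  induction t with
  | zero => exact_mod_cast isDumbbell_dumbbellLine hk
  | succ t ih =>
    push_cast at ht ⊢
    exact (ih (by linarith)).succ hk (by linarith) _

theorem IsDumbbell.not_converged {k : ℕ} (hk : 10 ≤ k) {t : ℝ} {x : ℕ → ℝ}
    (h : IsDumbbell k t x) : ¬ Converged fun i : Fin (3 * k + 1) => x i := by
  intro hc
  have hkR : (10 : ℝ) ≤ k := by exact_mod_cast hk
  have h1 : 0 < (1 - 1 / (2 * (k : ℝ))) / (k + 2) := by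
    have : 1 / (2 * (k : ℝ)) ≤ 1 / 20 := one_div_le_one_div_of_le (by norm_num) (by linarith)
    exact div_pos (by linarith) (by linarith)
  have h2 : 1 / (k : ℝ) ≤ 1 / 10 := one_div_le_one_div_of_le (by norm_num) hkR
  have h3 := h.le_gap
  have h4 := h.gap_le
  rcases hc ⟨k, by omega⟩ ⟨0, by omega⟩ with h5 | h5
  · simp only at h5
    linarith
  · simp only at h5
    rw [abs_of_pos (by linarith)] at h5
    linarith

theorem exists_converged_noControl (k : ℕ) :
    ∃ t, Converged (opinions (dumbbell k) noControl t) := by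
  refine ⟨0 + 4 * (3 * k + 1) ^ 3, ?_⟩
  rw [dumbbell_eq, opinions_eq_lineOpinions]
  have hX : FreeOrbit (3 * k + 1) (lineOpinions (3 * k + 1) (dumbbellLine k) noControl)
      noControl :=
    ⟨fun _ => rfl, fun _ _ _ s => s.elim0, sorted_dumbbellLine _ _⟩
  exact (hX.resolved_of_card le_rfl (3 * k + 1) (by omega) le_rfl cut_zero cut_self
    le_rfl).converged

theorem exists_le_uncontrolledConvergenceTime : ∃ c : ℝ, 0 < c ∧ ∀ k : ℕ, 10 ≤ k → ∃ T : ℕ,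
    uncontrolledConvergenceTime (dumbbell k) = (T : ℕ∞) ∧
      c * ((3 * k + 1 : ℕ) : ℝ) ^ 2 ≤ (T : ℝ) := by
  refine ⟨1 / 16000, by norm_num, fun k hk => ?_⟩
  have hkR : (10 : ℝ) ≤ k := by exact_mod_cast hk
  have hdef : uncontrolledConvergenceTime (dumbbell k) =
      convergenceTime (dumbbell k) noControl := rfl
  obtain ⟨t, ht⟩ := exists_converged_noControl k
  obtain ⟨T, hT⟩ := ENat.ne_top_iff_exists.1
    (ne_top_of_le_ne_top (ENat.natCast_ne_top t) (convergenceTime_le ht))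
  refine ⟨T, by rw [hdef, hT], ?_⟩
  have hle : ((⌊(k : ℝ) ^ 2 / 1000⌋₊ + 1 : ℕ) : ℕ∞) ≤ T := by
    rw [hT]
    refine le_iInf₂ fun s hs => ?_
    rw [ENat.natCast_le_natCast]
    by_contra! hlt
    have hs' : (s : ℝ) ≤ (k : ℝ) ^ 2 / 1000 :=
      (Nat.le_floor_iff (by positivity)).1 (by omega)
    rw [dumbbell_eq, opinions_eq_lineOpinions] at hs
    exact (isDumbbell_lineOpinions hk hs').not_converged hk hs
  rw [ENat.natCast_le_natCast] at hle
  have h1 : (k : ℝ) ^ 2 / 1000 < T :=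
    (Nat.lt_floor_add_one _).trans_le (by exact_mod_cast hle)
  push_cast
  nlinarith

end HegselmannKrause

theorem mainTheorem6 :
    (∃ c : ℝ, 0 < c ∧ ∀ k : ℕ, 10 ≤ k → ∃ T : ℕ,
      HegselmannKrause.uncontrolledConvergenceTime (HegselmannKrause.dumbbell k) = (T : ℕ∞) ∧
        c * ((3 * k + 1 : ℕ) : ℝ) ^ 2 ≤ (T : ℝ)) ∧
    (∃ C : ℝ, 0 < C ∧ ∀ k : ℕ, 10 ≤ k → ∃ T : ℕ,
      HegselmannKrause.optimalConvergenceTime (HegselmannKrause.dumbbell k) 1 = (T : ℕ∞) ∧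
        (T : ℝ) ≤ C * ((3 * k + 1 : ℕ) : ℝ) ^ (3 / 4 : ℝ)) ∧
    (∀ k : ℕ, 10 ≤ k → ∀ u : ℕ → Fin 1 → ℝ, u 0 0 = 2 → u 1 0 = (k : ℝ) - 2 →
      HegselmannKrause.opinions (HegselmannKrause.dumbbell k) u 2 =
        HegselmannKrause.almostEquidistantChain k) := by
  refine ⟨HegselmannKrause.exists_le_uncontrolledConvergenceTime,
    HegselmannKrause.exists_optimalConvergenceTime_le, fun k hk u h0 h1 => ?_⟩
  rw [HegselmannKrause.dumbbell_eq, HegselmannKrause.opinions_eq_lineOpinions]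
  exact (HegselmannKrause.afterTwoSteps hk h0 h1).eq_almostEquidistantChain hk
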